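/- **Lemma (Extremal functions for the Poisson kernel).** Let $\beta>0$ and $\Delta>0$ be real numbers and let $h_\beta(x)=\frac{\beta}{\beta^2+x^2}$ for $x\in\mathbb{R}$. A real entire function is an entire function whose restriction to $\mathbb{R}$ is real-valued, and an entire function $G$ has exponential type $\tau$ if $\limsup_{|z|\to\infty}\frac{\log|G(z)|}{|z|}\le\tau$. There is a unique pair of real entire functions $m^-_{\beta,\Delta},\,m^+_{\beta,\Delta}:\mathbb{C}\to\mathbb{C}$ with the following properties: (i) $m^{\pm}_{\beta,\Delta}$ have exponential type $2\pi\Delta$; (ii) $m^-_{\beta,\Delta}(x)\le h_\beta(x)\le m^+_{\beta,\Delta}(x)$ for all $x\in\mathbb{R}$; (iii) among all pairs of real entire functions satisfying (i) and (ii), the integral $\int_{-\infty}^{\infty}\{m^+_{\beta,\Delta}(x)-m^-_{\beta,\Delta}(x)\}\,dx\in[0,\infty]$ is minimal. The functions $m^{\pm}_{\beta,\Delta}$ are even, they are integrable on $\mathbb{R}$, and the following hold. (iv) $$\int_{-\infty}^{\infty}\{m^+_{\beta,\Delta}(x)-h_\beta(x)\}\,dx=\frac{2\pi e^{-2\pi\beta\Delta}}{1-e^{-2\pi\beta\Delta}},\qquad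 \int_{-\infty}^{\infty}\{h_\beta(x)-m^-_{\beta,\Delta}(x)\}\,dx=\frac{2\pi e^{-2\pi\beta\Delta}}{1+e^{-2\pi\beta\Delta}}.$$ (v) The Fourier transforms $\widehat m^{\pm}_{\beta,\Delta}(\xi)=\int_{-\infty}^{\infty}m^{\pm}_{\beta,\Delta}(x)e^{-2\pi i x\xi}\,dx$ are even continuous functions that vanish for $|\xi|>\Delta$, and for $|\xi|\le\Delta$ $$\widehat m^{\pm}_{\beta,\Delta}(\xi)=\pi\,\frac{e^{2\pi\beta(\Delta-|\xi|)}-e^{-2\pi\beta(\Delta-|\xi|)}}{\left(e^{\pi\beta\Delta}\mp e^{-\pi\beta\Delta}\right)^2}.$$ (vi) For all $z\in\mathbb{C}$ with $z\neq\pm i\beta$ (these two points being removable singularities of the right-hand side), $$m^{\pm}_{\beta,\Delta}(z)=\left(\frac{\beta}{\beta^2+z^2}\right)\frac{e^{2\pi\beta\Delta}+e^{-2\pi\beta\Delta}-2\cos(2\pi\Delta z)}{\left(e^{\pi\beta\Delta}\mp e^{-\pi\beta\Delta}\right)^2}.$$ In particular, $m^-_{\beta,\Delta}$ is nonnegative on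 $\mathbb{R}$. (vii) There is a universal constant $C>0$ (independent of $\beta$, $\Delta$, $x$ and $z$) such that, whenever $0<\beta\le\frac12$ and $\Delta\ge1$, for all $x\in\mathbb{R}$ $$0<m^-_{\beta,\Delta}(x)\le h_\beta(x)\le m^+_{\beta,\Delta}(x)\le\frac{C}{\beta(1+x^2)},$$ and for all $z=x+iy\in\mathbb{C}$ $$|m^+_{\beta,\Delta}(z)|\le C\,\frac{\Delta^2e^{2\pi\Delta|y|}}{\beta(1+\Delta|z|)},\qquad |m^-_{\beta,\Delta}(z)|\le C\,\frac{\beta\Delta^2e^{2\pi\Delta|y|}}{1+\Delta|z|}.$$ -/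

import Mathlib

open MeasureTheory Filter
open scoped Real FourierTransform ENNReal

noncomputable section

/-- The Poisson kernel `h_β(x) = β / (β² + x²)`. -/
def linePoissonKernel (β x : ℝ) : ℝ := β / (β ^ 2 + x ^ 2)

/-- A real entire function: an entire function that is real-valued on the real line. -/
def IsRealEntire (G : ℂ → ℂ) : Prop :=
  Differentiable ℂ G ∧ ∀ x : ℝ, (G x).im = 0

/-- `G` has exponential type `τ`: `limsup_{|z| → ∞} log |G z| / |z| ≤ τ`.
The limsup is taken in the extended reals, with `log 0 = -∞`. -/
def HasExponentialType (τ : ℝ) (G : ℂ → ℂ) : Prop :=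
  limsup (fun z : ℂ => ENNReal.log ‖G z‖ₑ / ((‖z‖ : ℝ) : EReal)) (Bornology.cobounded ℂ)
    ≤ (τ : EReal)

/-- `mMinus` and `mPlus` are real entire functions of exponential type `2πΔ` with
`mMinus ≤ h_β ≤ mPlus` on the real line. -/
structure IsAdmissiblePair (β Δ : ℝ) (mMinus mPlus : ℂ → ℂ) : Prop where
  realEntire_minus : IsRealEntire mMinus
  realEntire_plus : IsRealEntire mPlus
  expType_minus : HasExponentialType (2 * π * Δ) mMinus
  expType_plus : HasExponentialType (2 * π * Δ) mPlus
  minorant : ∀ x : ℝ, (mMinus x).re ≤ linePoissonKernel β x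
  majorant : ∀ x : ℝ, linePoissonKernel β x ≤ (mPlus x).re

/-- The integral over the real line of `mPlus - mMinus`, as an element of `[0, ∞]`
(the integrand is nonnegative for admissible pairs). -/
def pairError (mMinus mPlus : ℂ → ℂ) : ℝ≥0∞ :=
  ∫⁻ x : ℝ, ENNReal.ofReal ((mPlus x).re - (mMinus x).re)

/-- An admissible pair that minimizes the integral of `mPlus - mMinus` among all
admissible pairs. -/
def IsExtremalPair (β Δ : ℝ) (mMinus mPlus : ℂ → ℂ) : Prop :=
  IsAdmissiblePair β Δ mMinus mPlus ∧
    ∀ gMinus gPlus : ℂ → ℂ, IsAdmissiblePair β Δ gMinus gPlus →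
      pairError mMinus mPlus ≤ pairError gMinus gPlus

end

/-! Put `a = πβΔ`. The extremal functions are `h_β(x) (1 + sin²(πΔx) / sinh² a)` and `h_β(x) (1 -
cos²(πΔx) / cosh² a)`. By the double-angle formulas both equal `β (cosh 2a - cos 2πΔz) / (2κ (β² +
z²))`, with `κ = sinh² a` or `κ = cosh² a`. The numerator vanishes at `±iβ`, so they are entire;
they touch `h_β` exactly on the lattices `n/Δ` and `(n + 1/2)/Δ` respectively.

Optimality rests on quadrature. A function of type `2π` with quadratic decay has a Fourier transform
supported in `[-1, 1]` and vanishing at `±1`, so Poisson summation gives `∑ K(n) = ∫ K`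
(`QuadDecay.hasSum_int`). For a general competitor only an inequality is available: if `G ≥ 0` on
the real line is integrable of type `2π`, damping by a squared sinc gives `∑ G(n) ≤ ∫ G`
(`sum_int_le_integral`). The difference `D` of a majorant and the extremal majorant has no sign, but
`D` plus the gap between the two extremal functions is nonnegative, and the gap has exact
quadrature. Subtracting it leaves `∑ D ≤ Δ ∫ D` over the nodes, where every `D(node) ≥ 0`
(`node_excess_le`).

For uniqueness, `∫ D = 0` forces `D` to vanish at every node. There both functions touch `h_β` from
the same side, so their derivatives agree too and the zeros are double. After rescaling, `D /
sin²(πz)` is entire and bounded, hence constant, and integrability makes the constant zero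
(`eq_zero_of_double_zeros`). The problem for pairs splits into these two one-sided problems, because
a finite error makes each member integrable.

The Fourier transforms follow from that of `h_β`, since the factor `cos 2πΔx` only shifts
frequencies; the uniform bounds follow from writing the functions as products of two sincs. -/

/-! ### Exponential type, Phragmén–Lindelöf, and integrability on the real line -/

/-- Growth consequence of exponential type. -/
theorem HasExponentialType.exists_norm_le {τ : ℝ} {F : ℂ → ℂ} (hF : HasExponentialType τ F)
    (hc : Continuous F) {ε : ℝ} (hε : 0 < ε) :
    ∃ C : ℝ, 0 < C ∧ ∀ z, ‖F z‖ ≤ C * Real.exp ((τ + ε) * ‖z‖) := by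
  have h1 : ∀ᶠ z in Bornology.cobounded ℂ,
      ENNReal.log ‖F z‖ₑ / ((‖z‖ : ℝ) : EReal) < ((τ + ε : ℝ) : EReal) :=
    eventually_lt_of_limsup_lt (hF.trans_lt (by exact_mod_cast (by linarith)))
  obtain ⟨R, hR⟩ : ∃ R : ℝ, ∀ z : ℂ, R < ‖z‖ → ‖F z‖ ≤ Real.exp ((τ + ε) * ‖z‖) := by
    have h2 : ∀ᶠ z in Bornology.cobounded ℂ, ‖F z‖ ≤ Real.exp ((τ + ε) * ‖z‖) := by
      filter_upwards [h1, eventually_cobounded_le_norm (E := ℂ) 1] with z hz hz1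
      have hpos : (0 : EReal) < ((‖z‖ : ℝ) : EReal) := by exact_mod_cast (by linarith)
      rw [EReal.div_lt_iff hpos (EReal.coe_ne_top _), ← EReal.coe_mul] at hz
      have h3 := EReal.exp_strictMono hz
      rw [ENNReal.exp_log, EReal.exp_coe, ← ofReal_norm, ENNReal.ofReal_lt_ofReal_iff_of_nonneg
        (norm_nonneg _)] at h3
      exact h3.le
    obtain ⟨R, -, hR⟩ := (Metric.hasBasis_cobounded_compl_closedBall (0 : ℂ)).eventually_iff.1 h2
    exact ⟨R, fun z hz => hR (by simpa using hz)⟩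
  obtain ⟨B, hB⟩ := (isCompact_closedBall (0 : ℂ) R).exists_bound_of_continuousOn hc.continuousOn
  -- The term `1` serves outside the disc. Inside it the extra exponential is needed because `τ + ε`
  -- may be negative.
  refine ⟨1 + |B| * Real.exp (|τ + ε| * |R|), by positivity, fun z => ?_⟩
  rcases lt_or_ge R ‖z‖ with h | h
  · refine (hR z h).trans (le_mul_of_one_le_left (by positivity) ?_)
    linarith [show 0 ≤ |B| * Real.exp (|τ + ε| * |R|) by positivity]
  · have h0 : -((τ + ε) * ‖z‖) ≤ |τ + ε| * |R| := by
      calc -((τ + ε) * ‖z‖) ≤ |(τ + ε) * ‖z‖| := neg_le_abs _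
        _ = |τ + ε| * ‖z‖ := by rw [abs_mul, abs_norm]
        _ ≤ _ := by gcongr; exact h.trans (le_abs_self _)
    calc ‖F z‖ ≤ |B| * 1 := by rw [mul_one]; exact (hB z (by simpa using h)).trans (le_abs_self _)
      _ ≤ |B| * (Real.exp (|τ + ε| * |R|) * Real.exp ((τ + ε) * ‖z‖)) := by
        gcongr
        rw [← Real.exp_add]
        exact Real.one_le_exp (by linarith)
      _ ≤ _ := by
        rw [← mul_assoc]
        gcongr
        linarith

theorem hasExponentialType_of_norm_le {τ C : ℝ} {F : ℂ → ℂ}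
    (h : ∀ z, ‖F z‖ ≤ C * Real.exp (τ * ‖z‖)) : HasExponentialType τ F := by
  refine le_of_forall_gt_imp_ge_of_dense fun b hb => ?_
  obtain ⟨c, hc, hcb⟩ := EReal.lt_iff_exists_real_btwn.1 hb
  have hc' : τ < c := by exact_mod_cast hc
  refine le_trans ?_ hcb.le
  refine limsup_le_of_le (by isBoundedDefault) ?_
  -- For any `c > τ` the constant `C` is eventually absorbed by the surplus `exp ((c - τ)‖z‖)`.
  have hlim : ∀ᶠ z in Bornology.cobounded ℂ, C ≤ Real.exp ((c - τ) * ‖z‖) := by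
    have : Tendsto (fun z : ℂ => Real.exp ((c - τ) * ‖z‖)) (Bornology.cobounded ℂ) atTop :=
      Real.tendsto_exp_atTop.comp (tendsto_norm_cobounded_atTop.const_mul_atTop (by linarith))
    exact this.eventually_ge_atTop C
  filter_upwards [hlim, eventually_cobounded_le_norm (E := ℂ) 1] with z hz hz1
  have hpos : (0 : EReal) < ((‖z‖ : ℝ) : EReal) := by exact_mod_cast (by linarith)
  rw [EReal.div_le_iff_le_mul hpos (EReal.coe_ne_top _), ← EReal.coe_mul]
  rw [← EReal.exp_le_exp_iff, ENNReal.exp_log, EReal.exp_coe, ← ofReal_norm]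
  refine ENNReal.ofReal_le_ofReal ((h z).trans ?_)
  calc C * Real.exp (τ * ‖z‖) ≤ Real.exp ((c - τ) * ‖z‖) * Real.exp (τ * ‖z‖) := by gcongr
    _ = _ := by rw [← Real.exp_add]; ring_nf

/-- `F` grows no faster than `exp ((τ + ε) |z|)` for every `ε > 0`. -/
def GrowthType (τ : ℝ) (F : ℂ → ℂ) : Prop :=
  ∀ ε : ℝ, 0 < ε → ∃ C : ℝ, 0 < C ∧ ∀ z, ‖F z‖ ≤ C * Real.exp ((τ + ε) * ‖z‖)

theorem GrowthType.sub {τ : ℝ} {F G : ℂ → ℂ} (hF : GrowthType τ F) (hG : GrowthType τ G) :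
    GrowthType τ (fun z => F z - G z) := by
  intro ε hε
  obtain ⟨C, hC, h⟩ := hF ε hε
  obtain ⟨D, hD, h'⟩ := hG ε hε
  refine ⟨C + D, by positivity, fun z => (norm_sub_le _ _).trans ?_⟩
  rw [add_mul]
  exact add_le_add (h z) (h' z)

/-- Rescaling moves nodes `t + n / Δ` to the integers and type `2πΔ` to `2π`; the shift `t` costs
only a constant factor. -/
theorem GrowthType.comp_affine {τ Δ : ℝ} {F : ℂ → ℂ} (hτ : 0 ≤ τ) (hΔ : 0 < Δ)
    (hF : GrowthType (τ * Δ) F) (t : ℝ) : GrowthType τ (fun z => F (t + z / Δ)) := by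
  intro ε hε
  obtain ⟨C, hC, h⟩ := hF (ε * Δ) (by positivity)
  refine ⟨C * Real.exp ((τ + ε) * Δ * |t|), by positivity, fun z => (h _).trans ?_⟩
  rw [mul_assoc, ← Real.exp_add]
  gcongr
  have : ‖(t : ℂ) + z / Δ‖ ≤ |t| + ‖z‖ / Δ := by
    refine (norm_add_le _ _).trans (le_of_eq ?_)
    simp [abs_of_pos hΔ]
  calc (τ * Δ + ε * Δ) * ‖(t : ℂ) + z / Δ‖ ≤ (τ * Δ + ε * Δ) * (|t| + ‖z‖ / Δ) := by gcongr
    _ = _ := by field_simp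

/-- Phragmén–Lindelöf in a half-plane. A factor decaying at rate `τ + ε` makes the function bounded
along the axis of the half-plane and does not change its modulus on the boundary; then `ε → 0`. -/
theorem norm_le_of_bounded_on_real_upper {τ M : ℝ} {F : ℂ → ℂ} (hτ : 0 ≤ τ)
    (hd : Differentiable ℂ F) (hg : GrowthType τ F) (hM : ∀ x : ℝ, ‖F x‖ ≤ M) {z : ℂ}
    (hz : 0 ≤ z.im) : ‖F z‖ ≤ M * Real.exp (τ * z.im) := by
  have key : ∀ ε : ℝ, 0 < ε → ‖F z‖ ≤ M * Real.exp ((τ + ε) * z.im) := by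
    intro ε hε
    obtain ⟨C, hC, h⟩ := hg ε hε
    -- The rotation `w ↦ iw` carries the right half-plane onto the upper one.
    let G : ℂ → ℂ := fun w => Complex.exp (-(τ + ε) * w) * F (Complex.I * w)
    have hGn : ∀ w, ‖G w‖ = Real.exp (-(τ + ε) * w.re) * ‖F (Complex.I * w)‖ := by
      intro w
      rw [norm_mul, Complex.norm_exp]
      congr 2
      simp
    have hw := PhragmenLindelof.right_half_plane_of_bounded_on_real (f := G) (C := M)
      (z := -Complex.I * z) ?_ ?_ ?_ ?_ ?_
    · rw [hGn, ← mul_assoc] at hw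
      simp only [mul_neg, Complex.I_mul_I, neg_neg, one_mul] at hw
      have h1 : (-Complex.I * z).re = z.im := by simp
      rw [h1] at hw
      calc ‖F z‖ = Real.exp ((τ + ε) * z.im) * (Real.exp (-(τ + ε) * z.im) * ‖F z‖) := by
            rw [← mul_assoc, ← Real.exp_add, neg_mul, add_neg_cancel, Real.exp_zero, one_mul]
        _ ≤ Real.exp ((τ + ε) * z.im) * M := by gcongr
        _ = _ := mul_comm _ _
    · apply Differentiable.diffContOnCl
      fun_prop
    -- Order one is below the critical order two of a half-plane; each of the two factors
    -- contributes `τ + ε`.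
    · refine ⟨1, by norm_num, 2 * (τ + ε), ?_⟩
      refine Asymptotics.IsBigO.of_bound C (Eventually.of_forall fun w => ?_)
      rw [hGn, Real.rpow_one, Real.norm_eq_abs, Real.abs_exp]
      calc _ ≤ Real.exp ((τ + ε) * ‖w‖) * (C * Real.exp ((τ + ε) * ‖Complex.I * w‖)) := by
            gcongr ?_ * ?_
            · apply Real.exp_le_exp.2
              have := abs_le.1 (Complex.abs_re_le_norm w)
              nlinarith
            · exact h _
        _ = _ := by
            rw [norm_mul, Complex.norm_I, one_mul, mul_left_comm, ← Real.exp_add]; ring_nf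
    · refine ⟨C, ?_⟩
      rw [eventually_map]
      filter_upwards [eventually_ge_atTop 0] with x hx
      rw [hGn]
      calc _ ≤ Real.exp (-(τ + ε) * x) * (C * Real.exp ((τ + ε) * ‖Complex.I * x‖)) := by
            gcongr ?_ * ?_
            · simp
            · exact h _
        _ = C := by
            rw [norm_mul, Complex.norm_I, one_mul, mul_left_comm, ← Real.exp_add, Complex.norm_real,
              Real.norm_eq_abs, abs_of_nonneg hx, neg_mul, neg_add_cancel, Real.exp_zero, mul_one]
    · intro x
      rw [hGn]
      have : Complex.I * (x * Complex.I) = ((-x : ℝ) : ℂ) := by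
        push_cast; linear_combination (x : ℂ) * Complex.I_mul_I
      rw [this]
      simpa using hM (-x)
    · simpa using hz
  refine ge_of_tendsto (x := nhdsWithin 0 (Set.Ioi (0:ℝ)))
    (f := fun ε : ℝ => M * Real.exp ((τ + ε) * z.im)) ?_ ?_
  · refine Tendsto.mono_left ?_ nhdsWithin_le_nhds
    exact Continuous.tendsto' (by fun_prop) _ _ (by simp)
  · filter_upwards [self_mem_nhdsWithin] with ε hε using key ε hε

theorem norm_le_of_bounded_on_real {τ M : ℝ} {F : ℂ → ℂ} (hτ : 0 ≤ τ)
    (hd : Differentiable ℂ F) (hg : GrowthType τ F) (hM : ∀ x : ℝ, ‖F x‖ ≤ M) (z : ℂ) :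
    ‖F z‖ ≤ M * Real.exp (τ * |z.im|) := by
  rcases le_total 0 z.im with h | h
  · rw [abs_of_nonneg h]
    exact norm_le_of_bounded_on_real_upper hτ hd hg hM h
  · rw [abs_of_nonpos h]
    have := norm_le_of_bounded_on_real_upper (F := fun w => F (-w)) (z := -z) (M := M) hτ
      (hd.comp differentiable_neg) (fun ε hε => ?_) (fun x => ?_) (by simpa using h)
    · simpa using this
    · obtain ⟨C, hC, h⟩ := hg ε hε
      exact ⟨C, hC, fun z => by simpa using h (-z)⟩
    · simpa using hM (-x)

/-- Integrability of `F` does not bound `F` on the real line directly, but it bounds a primitive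
there by `∫ ‖F‖`. Integrating along an axis-parallel path from `0` keeps the exponential type. -/
theorem exists_primitive_bounded_on_real {τ : ℝ} {F : ℂ → ℂ} (hτ : 0 ≤ τ)
    (hd : Differentiable ℂ F) (hg : GrowthType τ F) (hi : Integrable fun x : ℝ => F x) :
    ∃ P : ℂ → ℂ, (∀ z, HasDerivAt P (F z) z) ∧ GrowthType τ P ∧
      ∃ M, ∀ x : ℝ, ‖P x‖ ≤ M := by
  refine ⟨fun z => Complex.wedgeIntegral 0 z F, fun z => ?_, fun ε hε => ?_,
    ∫ x : ℝ, ‖F x‖, fun x => ?_⟩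
  · exact (hd.differentiableOn.isConservativeOn.mono (Set.subset_univ _)).hasDerivAt_wedgeIntegral
      (r := ‖z‖ + 1) hd.continuous.continuousOn (by simp)
  -- The other half of `ε` absorbs the path length, which is at most `2‖z‖`.
  · obtain ⟨C, hC, h⟩ := hg (ε / 2) (by positivity)
    refine ⟨2 * C * (2 / ε), by positivity, fun z => ?_⟩
    have hb : ∀ w : ℂ, ‖w‖ ≤ ‖z‖ → ‖F w‖ ≤ C * Real.exp ((τ + ε / 2) * ‖z‖) := by
      intro w hw
      refine (h w).trans ?_
      gcongr
    have h1 : ‖Complex.wedgeIntegral 0 z F‖ ≤ 2 * (C * Real.exp ((τ + ε / 2) * ‖z‖) * ‖z‖) := by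
      rw [Complex.wedgeIntegral, two_mul]
      refine (norm_add_le _ _).trans (add_le_add ?_ ?_)
      · refine (intervalIntegral.norm_integral_le_of_norm_le_const
          (C := C * Real.exp ((τ + ε / 2) * ‖z‖)) ?_).trans ?_
        · intro x hx
          refine hb _ ?_
          simp only [Complex.zero_re, Complex.zero_im] at hx ⊢
          simp only [Complex.ofReal_zero, zero_mul, add_zero, Complex.norm_real, Real.norm_eq_abs]
          refine le_trans ?_ (Complex.abs_re_le_norm z)
          rcases Set.mem_uIoc.1 hx with hx | hx
          · rw [abs_of_pos hx.1]; exact hx.2.trans (le_abs_self _)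
          · rw [abs_of_nonpos hx.2]; exact (by linarith [neg_le_abs z.re])
        · gcongr
          simpa using Complex.abs_re_le_norm z
      · rw [norm_smul, Complex.norm_I, one_mul]
        refine (intervalIntegral.norm_integral_le_of_norm_le_const
          (C := C * Real.exp ((τ + ε / 2) * ‖z‖)) ?_).trans ?_
        · intro y hy
          refine hb _ ?_
          simp only [Complex.zero_im] at hy
          have hy2 : |y| ≤ |z.im| := by
            rcases Set.mem_uIoc.1 hy with hx | hx
            · rw [abs_of_pos hx.1]; exact hx.2.trans (le_abs_self _)
            · rw [abs_of_nonpos hx.2]; exact (by linarith [neg_le_abs z.im])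
          rw [← Complex.re_add_im z, Complex.norm_add_mul_I, Complex.norm_add_mul_I]
          simp only [Complex.re_add_im]
          exact Real.sqrt_le_sqrt (by linarith [sq_le_sq.2 hy2])
        · gcongr
          simpa using Complex.abs_im_le_norm z
    refine h1.trans ?_
    have h2 : ‖z‖ ≤ 2 / ε * Real.exp (ε / 2 * ‖z‖) := by
      have := Real.add_one_le_exp (ε / 2 * ‖z‖)
      calc ‖z‖ = 2 / ε * (ε / 2 * ‖z‖) := by field_simp
        _ ≤ _ := by gcongr; linarith
    calc 2 * (C * Real.exp ((τ + ε / 2) * ‖z‖) * ‖z‖)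
        ≤ 2 * (C * Real.exp ((τ + ε / 2) * ‖z‖) * (2 / ε * Real.exp (ε / 2 * ‖z‖))) := by gcongr
      _ = 2 * C * (2 / ε) * (Real.exp ((τ + ε / 2) * ‖z‖) * Real.exp (ε / 2 * ‖z‖)) := by ring
      _ = _ := by rw [← Real.exp_add]; ring_nf
  · simp only [Complex.wedgeIntegral, Complex.zero_re, Complex.zero_im, Complex.ofReal_re,
      Complex.ofReal_im, intervalIntegral.integral_same, smul_zero, add_zero, Complex.ofReal_zero,
      zero_mul]
    refine intervalIntegral.norm_integral_le_integral_norm_uIoc.trans ?_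
    exact setIntegral_le_integral hi.norm (Eventually.of_forall fun x => norm_nonneg _)

/-- An entire function of exponential type that is integrable on the real line is bounded on
horizontal lines. -/
theorem exists_norm_le_exp_im_of_integrable {τ : ℝ} {F : ℂ → ℂ} (hτ : 0 ≤ τ)
    (hd : Differentiable ℂ F) (hg : GrowthType τ F) (hi : Integrable fun x : ℝ => F x) :
    ∃ M : ℝ, ∀ z, ‖F z‖ ≤ M * Real.exp (τ * |z.im|) := by
  obtain ⟨P, hP, hPg, M, hM⟩ := exists_primitive_bounded_on_real hτ hd hg hi
  have hPd : Differentiable ℂ P := fun z => (hP z).differentiableAt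
  have hb := norm_le_of_bounded_on_real hτ hPd hPg hM
  have hM0 : 0 ≤ M := (norm_nonneg _).trans (hM 0)
  refine ⟨M * Real.exp τ, fun z => ?_⟩
  -- Cauchy's estimate on the unit circle around `z` passes from the primitive back to `F`, at the
  -- cost of a factor `exp τ`.
  have h1 := Complex.norm_deriv_le_of_forall_mem_sphere_norm_le (f := P) (c := z) (R := 1)
    (C := M * Real.exp (τ * (|z.im| + 1))) one_pos hPd.diffContOnCl fun w hw => by
      refine (hb w).trans ?_
      gcongr
      have h2 : |w.im - z.im| ≤ 1 := by
        have := Complex.abs_im_le_norm (w - z)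
        rwa [mem_sphere_iff_norm.1 hw, Complex.sub_im] at this
      have := abs_sub_abs_le_abs_sub w.im z.im
      linarith
  rw [(hP z).deriv, div_one] at h1
  refine h1.trans (le_of_eq ?_)
  rw [mul_assoc, ← Real.exp_add]
  ring_nf

/-! ### Bounds for sine and the entire sinc function -/

noncomputable section

theorem norm_cos_le_exp_abs_im (z : ℂ) : ‖Complex.cos z‖ ≤ Real.exp |z.im| := by
  have h1 : ‖Complex.exp (z * Complex.I)‖ ≤ Real.exp |z.im| := by
    rw [Complex.norm_exp]; gcongr; simpa using neg_le_abs z.im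
  have h2 : ‖Complex.exp (-z * Complex.I)‖ ≤ Real.exp |z.im| := by
    rw [Complex.norm_exp]; gcongr; simpa using le_abs_self z.im
  rw [Complex.cos, norm_div, Complex.norm_ofNat, div_le_iff₀ two_pos]
  linarith [norm_add_le (Complex.exp (z * Complex.I)) (Complex.exp (-z * Complex.I))]

theorem norm_sin_le_exp_abs_im (z : ℂ) : ‖Complex.sin z‖ ≤ Real.exp |z.im| := by
  have := norm_cos_le_exp_abs_im (π / 2 - z)
  rw [Complex.cos_pi_div_two_sub] at this
  have h : ((π : ℂ) / 2 - z).im = -z.im := by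
    rw [show (π : ℂ) / 2 = ((π / 2 : ℝ) : ℂ) by push_cast; rfl]; simp
  rwa [h, abs_neg] at this

/-- Mean value inequality on the segment from `0` to `z`, along which `|Im w| ≤ |Im z|`. -/
theorem norm_sin_le_norm_mul (z : ℂ) : ‖Complex.sin z‖ ≤ Real.exp |z.im| * ‖z‖ := by
  have h := Convex.norm_image_sub_le_of_norm_deriv_le (f := Complex.sin)
    (s := segment ℝ 0 z) (C := Real.exp |z.im|) (x := 0) (y := z)
    (fun w _ => Complex.differentiable_sin w) (fun w hw => ?_) (convex_segment _ _)
    (left_mem_segment _ _ _) (right_mem_segment _ _ _)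
  · simpa using h
  · rw [Complex.deriv_sin]
    refine (norm_cos_le_exp_abs_im w).trans (Real.exp_le_exp.2 ?_)
    obtain ⟨a, b, ha, hb, hab, rfl⟩ := hw
    have : (a • (0 : ℂ) + b • z).im = b * z.im := by simp
    rw [this, abs_mul, abs_of_nonneg hb]
    exact mul_le_of_le_one_left (abs_nonneg _) (by linarith)

/-- The entire function `sin z / z`. -/
def csinc : ℂ → ℂ := dslope Complex.sin 0

theorem differentiable_csinc : Differentiable ℂ csinc := by
  rw [← differentiableOn_univ]
  exact (Complex.differentiableOn_dslope univ_mem).2 Complex.differentiable_sin.differentiableOn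

theorem mul_csinc (z : ℂ) : z * csinc z = Complex.sin z := by
  have := sub_smul_dslope Complex.sin 0 z
  rwa [sub_zero, Complex.sin_zero, sub_zero, smul_eq_mul] at this

theorem csinc_zero : csinc 0 = 1 := by
  simp [csinc, dslope_same]

theorem csinc_neg (z : ℂ) : csinc (-z) = csinc z := by
  rcases eq_or_ne z 0 with rfl | hz
  · simp
  · refine mul_left_cancel₀ (neg_ne_zero.2 hz) ?_
    rw [mul_csinc, neg_mul, mul_csinc, Complex.sin_neg]

theorem norm_csinc_le (z : ℂ) : ‖csinc z‖ ≤ Real.exp |z.im| := by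
  rcases eq_or_ne z 0 with rfl | hz
  · simp [csinc_zero]
  · have hz' : 0 < ‖z‖ := norm_pos_iff.2 hz
    have := norm_sin_le_norm_mul z
    rw [← mul_csinc, norm_mul, mul_comm] at this
    exact le_of_mul_le_mul_right this hz'

/-- Both `‖csinc z‖` and `‖z csinc z‖ = ‖sin z‖` are at most `exp |Im z|`; adding the two bounds
gives the factor `2`. -/
theorem norm_csinc_le_div (z : ℂ) : ‖csinc z‖ ≤ 2 * Real.exp |z.im| / (1 + ‖z‖) := by
  rw [le_div_iff₀ (by positivity)]
  have h1 := norm_csinc_le z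
  have h2 := norm_sin_le_exp_abs_im z
  rw [← mul_csinc, norm_mul] at h2
  linarith

theorem csinc_ofReal_im (x : ℝ) : (csinc x).im = 0 := by
  rcases eq_or_ne x 0 with rfl | hx
  · simp [csinc_zero]
  · have h : csinc x = ((Real.sin x / x : ℝ) : ℂ) := by
      refine mul_left_cancel₀ (Complex.ofReal_ne_zero.2 hx) ?_
      rw [mul_csinc]
      push_cast
      have : (x : ℂ) ≠ 0 := Complex.ofReal_ne_zero.2 hx
      field_simp
    rw [h, Complex.ofReal_im]

theorem norm_csinc_ofReal_le (x : ℝ) : ‖csinc x‖ ≤ 1 := by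
  simpa using norm_csinc_le x

/-! ### Contour shifts, Paley–Wiener vanishing and exact quadrature -/

theorem integrable_div_one_add_mul_sq (B : ℝ) {c : ℝ} (hc : 0 < c) :
    Integrable fun x : ℝ => B / (1 + (c * x) ^ 2) :=
  ((integrable_inv_one_add_sq.comp_mul_left' hc.ne').const_mul B).congr
    (Eventually.of_forall fun x => by simp [div_eq_mul_inv])

theorem tendsto_one_add_mul_sq_atTop {c : ℝ} (hc : 0 < c) :
    Tendsto (fun R : ℝ => 1 + (c * R) ^ 2) atTop atTop :=
  tendsto_atTop_add_const_left _ _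
    ((tendsto_pow_atTop two_ne_zero).comp (tendsto_id.const_mul_atTop hc))

/-- Horizontal contour shift for functions with quadratic decay in a strip. -/
theorem integral_horizontal_shift {G : ℂ → ℂ} (hG : Differentiable ℂ G) {B c y : ℝ} (hc : 0 < c)
    (hb : ∀ z : ℂ, |z.im| ≤ |y| → ‖G z‖ ≤ B / (1 + (c * z.re) ^ 2)) :
    ∫ x : ℝ, G (x + y * Complex.I) = ∫ x : ℝ, G x := by
  have hcont : ∀ t : ℝ, Continuous fun x : ℝ => G (x + t * Complex.I) := fun t =>
    hG.continuous.comp (by fun_prop)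
  have hint : ∀ t : ℝ, |t| ≤ |y| → Integrable fun x : ℝ => G (x + t * Complex.I) := fun t ht =>
    (integrable_div_one_add_mul_sq B hc).mono' (hcont t).aestronglyMeasurable
      (Eventually.of_forall fun x => by
        simpa using hb (x + t * Complex.I) (by simpa using ht))
  -- Cauchy's theorem on the rectangle `[-R, R] × [0, y]`.
  have hrect : ∀ R : ℝ, (∫ x : ℝ in -R..R, G (x + (0 : ℝ) * Complex.I)) -
      (∫ x : ℝ in -R..R, G (x + y * Complex.I)) =
      -(Complex.I • ∫ t : ℝ in (0)..y, G (R + t * Complex.I)) +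
        Complex.I • ∫ t : ℝ in (0)..y, G ((-R : ℝ) + t * Complex.I) := by
    intro R
    have h := Complex.integral_boundary_rect_eq_zero_of_differentiableOn G ((-R : ℝ) : ℂ)
      (R + y * Complex.I) hG.differentiableOn
    simp only [Complex.ofReal_re, Complex.ofReal_im, Complex.add_re, Complex.mul_re, Complex.I_re,
      Complex.I_im, mul_zero, sub_zero, add_zero, Complex.add_im, Complex.mul_im,
      zero_add, mul_one] at h
    linear_combination h
  -- The sign `s = ±1` treats both vertical sides together.
  have hside : ∀ s : ℝ, |s| = 1 → Tendsto (fun R : ℝ => ∫ t : ℝ in (0)..y,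
      G ((s * R : ℝ) + t * Complex.I)) atTop (nhds 0) := by
    intro s hs
    have hlim : Tendsto (fun R : ℝ => B / (1 + (c * R) ^ 2) * |y - 0|) atTop (nhds 0) := by
      simpa using (tendsto_const_nhds.div_atTop (tendsto_one_add_mul_sq_atTop hc)).mul_const |y - 0|
    refine squeeze_zero_norm (fun R => ?_) hlim
    refine intervalIntegral.norm_integral_le_of_norm_le_const fun t ht => ?_
    have h1 := hb ((s * R : ℝ) + t * Complex.I) (by
      simp only [Complex.add_im, Complex.ofReal_im, Complex.mul_im, Complex.ofReal_re,
        Complex.I_im, Complex.I_re, mul_one, mul_zero, add_zero, zero_add]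
      rcases Set.mem_uIoc.1 ht with hx | hx
      · rw [abs_of_pos hx.1]; exact hx.2.trans (le_abs_self _)
      · rw [abs_of_nonpos hx.2]; linarith [neg_le_abs y])
    refine h1.trans (le_of_eq ?_)
    have h2 : (c * (((s * R : ℝ) : ℂ) + t * Complex.I).re) ^ 2 = (c * R) ^ 2 * |s| ^ 2 := by
      rw [sq_abs]; simp; ring
    rw [h2, hs]; simp
  have h1 := intervalIntegral_tendsto_integral (hint 0 (by simp)) tendsto_neg_atTop_atBot
    tendsto_id
  have h2 := intervalIntegral_tendsto_integral (hint y le_rfl) tendsto_neg_atTop_atBot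
    tendsto_id
  have h3 := h1.sub h2
  have h4 : Tendsto (fun R : ℝ => -(Complex.I • ∫ t : ℝ in (0)..y, G (R + t * Complex.I)) +
        Complex.I • ∫ t : ℝ in (0)..y, G ((-R : ℝ) + t * Complex.I)) atTop (nhds 0) := by
    have := ((hside 1 (by simp)).const_smul Complex.I).neg.add
      ((hside (-1) (by simp)).const_smul Complex.I)
    simpa using this
  have h5 := tendsto_nhds_unique (h3.congr fun R => hrect R) h4
  simp only [Complex.ofReal_zero, zero_mul, add_zero] at h5
  exact (sub_eq_zero.1 h5).symm

/-- An entire function of type `2π` with quadratic decay along horizontal lines. -/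
structure QuadDecay (K : ℂ → ℂ) (M c : ℝ) : Prop where
  diff : Differentiable ℂ K
  pos : 0 < c
  bound : ∀ z : ℂ, ‖K z‖ ≤ M * Real.exp (2 * π * |z.im|) / (1 + (c * z.re) ^ 2)

namespace QuadDecay

variable {K : ℂ → ℂ} {M c : ℝ}

theorem nonneg (h : QuadDecay K M c) : 0 ≤ M := by
  simpa using (norm_nonneg _).trans (h.bound 0)

theorem bound_real (h : QuadDecay K M c) (x : ℝ) : ‖K x‖ ≤ M / (1 + (c * x) ^ 2) := by
  simpa using h.bound x

theorem continuous_real (h : QuadDecay K M c) : Continuous fun x : ℝ => K x :=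
  h.diff.continuous.comp Complex.continuous_ofReal

theorem integrable (h : QuadDecay K M c) : Integrable fun x : ℝ => K x :=
  (integrable_div_one_add_mul_sq M h.pos).mono' h.continuous_real.aestronglyMeasurable
    (Eventually.of_forall h.bound_real)

/-- Moving the contour to height `y = -sign(ξ) t` bounds the integral by a constant times `exp
(-2π(|ξ| - 1) t)`, which tends to `0`. -/
theorem fourier_eq_zero_of_one_lt (h : QuadDecay K M c) {ξ : ℝ} (hξ : 1 < |ξ|) :
    𝓕 (fun x : ℝ => K x) ξ = 0 := by
  have hM := h.nonneg
  have hc := h.pos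
  let G : ℂ → ℂ := fun z => Complex.exp (-2 * π * ξ * Complex.I * z) * K z
  have hGd : Differentiable ℂ G := by
    have := h.diff
    fun_prop
  have hGb : ∀ z, ‖G z‖ ≤ M * Real.exp (2 * π * (ξ * z.im + |z.im|)) / (1 + (c * z.re) ^ 2) := by
    intro z
    rw [norm_mul, Complex.norm_exp]
    have h1 : (-2 * π * ξ * Complex.I * z).re = 2 * π * ξ * z.im := by
      simp
    rw [h1]
    calc _ ≤ Real.exp (2 * π * ξ * z.im) *
          (M * Real.exp (2 * π * |z.im|) / (1 + (c * z.re) ^ 2)) := by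
          gcongr; exact h.bound z
      _ = M * (Real.exp (2 * π * ξ * z.im) * Real.exp (2 * π * |z.im|)) / (1 + (c * z.re) ^ 2) := by
          ring
      _ = _ := by rw [← Real.exp_add]; ring_nf
  have hFG : 𝓕 (fun x : ℝ => K x) ξ = ∫ x : ℝ, G x := by
    rw [Real.fourier_real_eq_integral_exp_smul]
    refine integral_congr_ae (Eventually.of_forall fun x => ?_)
    simp only [smul_eq_mul, G]
    congr 2
    push_cast
    ring
  have hshift : ∀ y : ℝ, ∫ x : ℝ, G (x + y * Complex.I) = ∫ x : ℝ, G x := by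
    intro y
    refine integral_horizontal_shift hGd (B := M * Real.exp (2 * π * (|ξ| * |y| + |y|))) hc ?_
    intro z hz
    refine (hGb z).trans ?_
    have h1 : ξ * z.im ≤ |ξ| * |y| := by
      refine (le_abs_self _).trans ?_
      rw [abs_mul]
      gcongr
    gcongr
  have hnorm : ∀ y : ℝ, ‖∫ x : ℝ, G x‖ ≤ Real.exp (2 * π * (ξ * y + |y|)) *
      ∫ x : ℝ, M / (1 + (c * x) ^ 2) := by
    intro y
    rw [← hshift y, ← integral_const_mul]
    refine norm_integral_le_of_norm_le
      ((integrable_div_one_add_mul_sq M hc).const_mul _) (Eventually.of_forall fun x => ?_)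
    refine (hGb _).trans (le_of_eq ?_)
    simp
    ring
  have hlim : Tendsto (fun t : ℝ => Real.exp (-(2 * π * (|ξ| - 1)) * t) *
      ∫ x : ℝ, M / (1 + (c * x) ^ 2)) atTop (nhds 0) := by
    have h1 : Tendsto (fun t : ℝ => Real.exp (-(2 * π * (|ξ| - 1)) * t)) atTop (nhds 0) := by
      refine Real.tendsto_exp_atBot.comp (tendsto_id.const_mul_atTop_of_neg ?_)
      have : 0 < 2 * π * (|ξ| - 1) := by have := Real.pi_pos; have : 0 < |ξ| - 1 := by linarith
                                         positivity
      linarith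
    simpa using h1.mul_const (∫ x : ℝ, M / (1 + (c * x) ^ 2))
  rw [hFG]
  refine norm_le_zero_iff.1 (ge_of_tendsto hlim ?_)
  filter_upwards [eventually_ge_atTop 0] with t ht
  refine (hnorm (-(SignType.sign ξ : ℝ) * t)).trans (le_of_eq ?_)
  have hξ0 : ξ ≠ 0 := by rintro rfl; norm_num at hξ
  congr 2
  have h1 : |-(SignType.sign ξ : ℝ) * t| = t := by
    rcases lt_or_gt_of_ne hξ0 with h0 | h0 <;> simp [h0, abs_of_nonneg ht]
  rw [h1]
  have h2 : ξ * (-(SignType.sign ξ : ℝ) * t) = -|ξ| * t := by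
    rw [← self_mul_sign ξ]; ring
  rw [h2]; ring

/-- The endpoints `|ξ| = 1` come by continuity. They matter because Poisson summation samples the
transform at `±1`. -/
theorem fourier_eq_zero (h : QuadDecay K M c) {ξ : ℝ} (hξ : 1 ≤ |ξ|) :
    𝓕 (fun x : ℝ => K x) ξ = 0 := by
  have hcont : Continuous (𝓕 (fun x : ℝ => K x)) :=
    VectorFourier.fourierIntegral_continuous Real.continuous_fourierChar
      (by exact continuous_inner) h.integrable
  have h1 : Tendsto (fun a : ℝ => 𝓕 (fun x : ℝ => K x) (a * ξ)) (nhdsWithin 1 (Set.Ioi 1))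
      (nhds (𝓕 (fun x : ℝ => K x) ξ)) := by
    refine Tendsto.mono_left ?_ nhdsWithin_le_nhds
    exact Continuous.tendsto' (hcont.comp (by fun_prop)) _ _ (by simp)
  refine tendsto_nhds_unique h1 (tendsto_const_nhds.congr' ?_)
  filter_upwards [self_mem_nhdsWithin] with a ha
  refine (h.fourier_eq_zero_of_one_lt ?_).symm
  have ha' : 1 < a := ha
  rw [abs_mul, abs_of_pos (by linarith)]
  nlinarith

/-- Exact quadrature at the integers. -/
theorem hasSum_int (h : QuadDecay K M c) : HasSum (fun n : ℤ => K n) (∫ x : ℝ, K x) := by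
  have hM := h.nonneg
  have hc := h.pos
  have hO : (fun x : ℝ => K x) =O[cocompact ℝ] fun x : ℝ => |x| ^ (-2 : ℝ) := by
    refine Asymptotics.IsBigO.of_bound (M / c ^ 2) ?_
    have : ∀ᶠ x : ℝ in cocompact ℝ, x ≠ 0 := by
      simpa using (isCompact_singleton (x := (0 : ℝ))).compl_mem_cocompact
    filter_upwards [this] with x hx
    refine (h.bound_real x).trans ?_
    have hx2 : 0 < x ^ 2 := by positivity
    rw [Real.norm_eq_abs, Real.abs_rpow_of_nonneg (abs_nonneg _), abs_abs,
      Real.rpow_neg (abs_nonneg _), Real.rpow_two, sq_abs, ← div_eq_mul_inv, div_div]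
    gcongr
    nlinarith
  have hzero : ∀ n : ℤ, n ≠ 0 → 𝓕 (fun x : ℝ => K x) n = 0 := fun n hn =>
    h.fourier_eq_zero (by exact_mod_cast Int.one_le_abs hn)
  have hS : Summable fun n : ℤ => 𝓕 (fun x : ℝ => K x) n :=
    summable_of_ne_finset_zero (s := {0}) fun n hn => hzero n (by simpa using hn)
  have hP := Real.tsum_eq_tsum_fourier_of_rpow_decay_of_summable h.continuous_real one_lt_two hO hS 0
  -- Only the zero frequency survives on the Fourier side.
  rw [tsum_eq_single (f := fun n : ℤ => 𝓕 (fun x : ℝ => K x) n * fourier n ((0 : ℝ) : UnitAddCircle))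
    0 fun n hn => by rw [hzero n hn, zero_mul]] at hP
  have h0 : 𝓕 (fun x : ℝ => K x) ((0 : ℤ) : ℝ) = ∫ x : ℝ, K x := by
    rw [Real.fourier_real_eq_integral_exp_smul]; simp
  rw [h0] at hP
  have hsum : Summable fun n : ℤ => K n := by
    have := summable_of_isBigO (Real.summable_abs_int_rpow one_lt_two)
      (hO.comp_tendsto Int.tendsto_coe_cofinite)
    simpa [Function.comp_def] using this
  have := hsum.hasSum
  simp only [zero_add, fourier_zero, mul_one, Complex.ofReal_intCast] at hP
  rwa [hP] at this

end QuadDecay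
end

/-! ### The quadrature inequality -/

noncomputable section

theorem csinc_ofReal_sq (x : ℝ) : csinc x ^ 2 = ((‖csinc x‖ ^ 2 : ℝ) : ℂ) := by
  have h : csinc x = ((csinc x).re : ℂ) := Complex.ext rfl (by simp [csinc_ofReal_im])
  rw [h, Complex.norm_real, Real.norm_eq_abs, sq_abs]
  push_cast
  rfl

/-- The dilation lowers the type to `2πr`, the squared sinc restores the missing `2π(1 - r)` and
supplies the decay. The `4` is the square of the constant in `norm_csinc_le_div`. -/
theorem quadDecay_mul_csinc_sq {G : ℂ → ℂ} {M : ℝ} (hd : Differentiable ℂ G)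
    (hG : ∀ z, ‖G z‖ ≤ M * Real.exp (2 * π * |z.im|)) {r : ℝ} (hr0 : 0 < r) (hr : r < 1) :
    QuadDecay (fun z => G (r * z) * csinc ((π * (1 - r) : ℝ) * z) ^ 2) (4 * M) (π * (1 - r)) where
  diff := by
    have := differentiable_csinc
    fun_prop
  pos := mul_pos Real.pi_pos (by linarith)
  bound z := by
    have hM : 0 ≤ M := by simpa using (norm_nonneg _).trans (hG 0)
    have hc : 0 < π * (1 - r) := mul_pos Real.pi_pos (by linarith)
    set c := π * (1 - r) with hcdef
    have h1 : ‖G (r * z)‖ ≤ M * Real.exp (2 * π * (r * |z.im|)) := by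
      simpa [abs_mul, abs_of_pos hr0] using hG (r * z)
    have h2 : ‖csinc ((c : ℝ) * z)‖ ≤ 2 * Real.exp (c * |z.im|) / (1 + c * ‖z‖) := by
      simpa [abs_mul, abs_of_pos hc] using norm_csinc_le_div ((c : ℝ) * z)
    rw [norm_mul, norm_pow]
    calc ‖G (r * z)‖ * ‖csinc ((c : ℝ) * z)‖ ^ 2
        ≤ M * Real.exp (2 * π * (r * |z.im|)) *
          (2 * Real.exp (c * |z.im|) / (1 + c * ‖z‖)) ^ 2 := by gcongr
      _ = 4 * M * (Real.exp (2 * π * (r * |z.im|)) * (Real.exp (c * |z.im|)) ^ 2) /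
          (1 + c * ‖z‖) ^ 2 := by rw [div_pow]; ring
      _ = 4 * M * Real.exp (2 * π * |z.im|) / (1 + c * ‖z‖) ^ 2 := by
          rw [← Real.exp_nat_mul, ← Real.exp_add, hcdef]
          congr 3
          push_cast
          ring
      _ ≤ _ := by
          have h3 : (c * z.re) ^ 2 ≤ (c * ‖z‖) ^ 2 := by
            calc _ = c ^ 2 * |z.re| ^ 2 := by rw [sq_abs]; ring
              _ ≤ c ^ 2 * ‖z‖ ^ 2 := by gcongr; exact Complex.abs_re_le_norm z
              _ = _ := by ring
          gcongr
          have : 0 ≤ c * ‖z‖ := by positivity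
          nlinarith

/-- Quadrature inequality for nonnegative integrable functions of exponential type `2π`. -/
theorem sum_int_le_integral {G : ℂ → ℂ} {M : ℝ} (hd : Differentiable ℂ G)
    (hG : ∀ z, ‖G z‖ ≤ M * Real.exp (2 * π * |z.im|)) (h0 : ∀ x : ℝ, 0 ≤ (G x).re)
    (hi : Integrable fun x : ℝ => G x) (s : Finset ℤ) :
    ∑ n ∈ s, (G n).re ≤ ∫ x : ℝ, (G x).re := by
  -- The damped function obeys exact quadrature. Its integral is at most that of the dilate because
  -- the damping lies in `[0, 1]` on the real line. Only finitely many nodes are kept, so `r → 1` is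
  -- harmless.
  have key : ∀ r : ℝ, 0 < r → r < 1 →
      ∑ n ∈ s, (G (r * n)).re * ‖csinc ((π * (1 - r) : ℝ) * n)‖ ^ 2 ≤
        r⁻¹ * ∫ x : ℝ, (G x).re := by
    intro r hr0 hr
    have hQ := quadDecay_mul_csinc_sq hd hG hr0 hr
    have hre : ∀ x : ℝ, (G (r * x) * csinc ((π * (1 - r) : ℝ) * x) ^ 2).re =
        (G (r * x)).re * ‖csinc ((π * (1 - r) : ℝ) * x)‖ ^ 2 := by
      intro x
      rw [← Complex.ofReal_mul (π * (1 - r)) x, csinc_ofReal_sq, Complex.re_mul_ofReal]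
    have h0' : ∀ x : ℝ, 0 ≤ (G (r * x)).re := fun x => by
      rw [← Complex.ofReal_mul]; exact h0 _
    have hsum := Complex.hasSum_re hQ.hasSum_int
    have hreint : (∫ x : ℝ, G (r * x) * csinc ((π * (1 - r) : ℝ) * x) ^ 2).re =
        ∫ x : ℝ, (G (r * x)).re * ‖csinc ((π * (1 - r) : ℝ) * x)‖ ^ 2 := by
      simp_rw [← hre]
      exact (integral_re hQ.integrable).symm
    have hsum' : HasSum (fun n : ℤ => (G (r * n)).re * ‖csinc ((π * (1 - r) : ℝ) * n)‖ ^ 2)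
        (∫ x : ℝ, (G (r * x)).re * ‖csinc ((π * (1 - r) : ℝ) * x)‖ ^ 2) := by
      rw [← hreint]
      refine hsum.congr_fun ?_
      intro n
      exact (hre n).symm
    have hGr : Integrable fun x : ℝ => (G (r * x)).re := by
      have := (hi.comp_mul_left' hr0.ne').re
      simpa using this
    calc _ ≤ ∫ x : ℝ, (G (r * x)).re * ‖csinc ((π * (1 - r) : ℝ) * x)‖ ^ 2 :=
          sum_le_hasSum _ (fun n _ => mul_nonneg (by simpa using h0' n) (by positivity)) hsum'
      _ ≤ ∫ x : ℝ, (G (r * x)).re := by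
          refine integral_mono_of_nonneg (Eventually.of_forall fun x => ?_) hGr
            (Eventually.of_forall fun x => ?_)
          · exact mul_nonneg (h0' x) (by positivity)
          · refine mul_le_of_le_one_right (h0' x) (pow_le_one₀ (norm_nonneg _) ?_)
            rw [← Complex.ofReal_mul]
            exact norm_csinc_ofReal_le _
      _ = _ := by
          have := Measure.integral_comp_mul_left (fun x : ℝ => (G x).re) r
          simp only [Complex.ofReal_mul] at this
          rw [this, abs_of_pos (inv_pos.2 hr0), smul_eq_mul]
  have hl : Tendsto (fun r : ℝ =>
      ∑ n ∈ s, (G (r * n)).re * ‖csinc ((π * (1 - r) : ℝ) * n)‖ ^ 2) (nhdsWithin 1 (Set.Iio 1))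
      (nhds (∑ n ∈ s, (G n).re)) := by
    refine Tendsto.mono_left ?_ nhdsWithin_le_nhds
    refine Continuous.tendsto' ?_ _ _ (by simp [csinc_zero])
    have h1 := hd.continuous
    have h2 := differentiable_csinc.continuous
    fun_prop
  have hr : Tendsto (fun r : ℝ => r⁻¹ * ∫ x : ℝ, (G x).re) (nhdsWithin 1 (Set.Iio 1))
      (nhds (∫ x : ℝ, (G x).re)) := by
    refine Tendsto.mono_left ?_ nhdsWithin_le_nhds
    simpa using (tendsto_inv₀ (one_ne_zero (α := ℝ))).mul_const (∫ x : ℝ, (G x).re)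
  refine le_of_tendsto_of_tendsto hl hr ?_
  filter_upwards [Ioo_mem_nhdsLT (zero_lt_one (α := ℝ))] with r hr using key r hr.1 hr.2

/-- Quadrature is an inequality for `F` and an equality for `A`, so the nonnegative excesses `F(n) -
A(n)` sum to at most `∫ F - ∫ A`. The difference itself may change sign between the integers. -/
theorem node_excess_le {F A : ℂ → ℂ} {M B c : ℝ} (hd : Differentiable ℂ F)
    (hF : ∀ z, ‖F z‖ ≤ M * Real.exp (2 * π * |z.im|)) (h0 : ∀ x : ℝ, 0 ≤ (F x).re)
    (hi : Integrable fun x : ℝ => F x) (hA : QuadDecay A B c)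
    (hFA : ∀ n : ℤ, (A n).re ≤ (F n).re) (m : ℤ) :
    (F m).re - (A m).re ≤ (∫ x : ℝ, (F x).re) - ∫ x : ℝ, (A x).re := by
  have hs := Complex.hasSum_re hA.hasSum_int
  have hre : (∫ x : ℝ, A x).re = ∫ x : ℝ, (A x).re := (integral_re hA.integrable).symm
  rw [hre] at hs
  have : ∫ x : ℝ, (A x).re ≤ (∫ x : ℝ, (F x).re) - ((F m).re - (A m).re) := by
    refine le_of_tendsto hs ?_
    filter_upwards [eventually_ge_atTop ({m} : Finset ℤ)] with s hms
    have hm : m ∈ s := hms (Finset.mem_singleton_self m)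
    have h1 := sum_int_le_integral hd hF h0 hi s
    have h2 : (F m).re - (A m).re ≤ ∑ n ∈ s, ((F n).re - (A n).re) :=
      Finset.single_le_sum (f := fun n : ℤ => (F n).re - (A n).re)
        (fun n _ => sub_nonneg.2 (hFA n)) hm
    rw [Finset.sum_sub_distrib] at h2
    linarith
  linarith

/-! ### Division by sine and vanishing from double zeros -/

theorem exists_entire_quotient {F s : ℂ → ℂ} (hF : Differentiable ℂ F) (hs : Differentiable ℂ s)
    (h : ∀ z, s z = 0 → F z = 0 ∧ deriv s z ≠ 0) :
    ∃ Q : ℂ → ℂ, Differentiable ℂ Q ∧ ∀ z, F z = Q z * s z := by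
  have hds : ∀ {f : ℂ → ℂ} (a : ℂ), Differentiable ℂ f → Differentiable ℂ (dslope f a) := by
    intro f a hf
    rw [← differentiableOn_univ]
    exact (Complex.differentiableOn_dslope univ_mem).2 hf.differentiableOn
  classical
  refine ⟨fun z => if s z = 0 then deriv F z / deriv s z else F z / s z, fun a => ?_, fun z => ?_⟩
  · by_cases ha : s a = 0
    -- Near a simple zero `a` of `s`, the quotient is that of the two divided slopes, whose
    -- denominator does not vanish.
    · have hne : dslope s a a ≠ 0 := by rw [dslope_same]; exact (h a ha).2
      have hev : ∀ᶠ z in nhds a, dslope s a z ≠ 0 := (hds a hs).continuous.continuousAt.eventually_ne hne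
      refine ((hds a hF a).div (hds a hs a) hne).congr_of_eventuallyEq ?_
      filter_upwards [hev] with z hz
      rcases eq_or_ne z a with rfl | hza
      · simp [ha, dslope_same]
      · have h1 := sub_smul_dslope s a z
        have h2 := sub_smul_dslope F a z
        rw [ha, sub_zero, smul_eq_mul] at h1
        rw [(h a ha).1, sub_zero, smul_eq_mul] at h2
        have hsz : s z ≠ 0 := by
          rw [← h1]; exact mul_ne_zero (sub_ne_zero.2 hza) hz
        simp only [Pi.div_apply]
        rw [if_neg hsz, ← h1, ← h2, mul_div_mul_left _ _ (sub_ne_zero.2 hza)]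
    · have hev : ∀ᶠ z in nhds a, s z ≠ 0 := hs.continuous.continuousAt.eventually_ne ha
      refine ((hF a).div (hs a) ha).congr_of_eventuallyEq ?_
      filter_upwards [hev] with z hz
      simp [hz]
  · by_cases hz : s z = 0
    · simp [hz, (h z hz).1]
    · simp [hz]

/-- At a zero of `s` the product rule gives `F' = Q s'`, so `Q` vanishes there as well and a second
division is possible. -/
theorem exists_entire_quotient_sq {F s : ℂ → ℂ} (hF : Differentiable ℂ F)
    (hs : Differentiable ℂ s) (h : ∀ z, s z = 0 → F z = 0 ∧ deriv F z = 0 ∧ deriv s z ≠ 0) :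
    ∃ Q : ℂ → ℂ, Differentiable ℂ Q ∧ ∀ z, F z = Q z * s z ^ 2 := by
  obtain ⟨Q, hQ, hFQ⟩ := exists_entire_quotient hF hs fun z hz => ⟨(h z hz).1, (h z hz).2.2⟩
  have hQ0 : ∀ z, s z = 0 → Q z = 0 := by
    intro z hz
    obtain ⟨-, h2, h3⟩ := h z hz
    have : F = fun z => Q z * s z := funext hFQ
    rw [this, deriv_fun_mul (hQ z) (hs z), hz, mul_zero, zero_add] at h2
    exact (mul_eq_zero.1 h2).resolve_right h3
  obtain ⟨R, hR, hQR⟩ := exists_entire_quotient hQ hs fun z hz => ⟨hQ0 z hz, (h z hz).2.2⟩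
  exact ⟨R, hR, fun z => by rw [hFQ, hQR]; ring⟩

/-- `‖sin w‖ ≥ sinh |Im w|`, and `exp (-|Im w|) ≤ 1 ≤ exp |Im w| / 2` away from the real axis. -/
theorem exp_abs_im_le_norm_sin {w : ℂ} (hw : 1 ≤ |w.im|) :
    Real.exp |w.im| ≤ 4 * ‖Complex.sin w‖ := by
  have hsinh : (Real.exp |w.im| - Real.exp (-|w.im|)) / 2 ≤ ‖Complex.sin w‖ := by
    have h1 : ‖Complex.exp (w * Complex.I)‖ = Real.exp (-w.im) := by
      rw [Complex.norm_exp]; simp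
    have h2 : ‖Complex.exp (-w * Complex.I)‖ = Real.exp w.im := by
      rw [Complex.norm_exp]; simp
    have h3 := abs_norm_sub_norm_le (Complex.exp (-w * Complex.I)) (Complex.exp (w * Complex.I))
    rw [h1, h2] at h3
    rw [Complex.sin, norm_div, norm_mul, Complex.norm_I, mul_one, Complex.norm_ofNat]
    gcongr
    refine le_trans ?_ h3
    rcases le_total 0 w.im with h | h
    · rw [abs_of_nonneg h]; exact le_abs_self _
    · rw [abs_of_nonpos h, neg_neg]
      exact (le_abs_self _).trans (abs_sub_comm _ _).le
  have h4 : Real.exp (-|w.im|) ≤ Real.exp |w.im| / 2 := by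
    have h5 : Real.exp (-|w.im|) ≤ 1 := Real.exp_le_one_iff.2 (by linarith)
    have h6 := Real.add_one_le_exp |w.im|
    linarith
  linarith

/-- Midway between consecutive zeros `|Re sin w| = cosh (Im w)`. -/
theorem exp_abs_im_le_norm_sin_of_half {w : ℂ} {k : ℤ} (hw : w.re = π * (k + 1 / 2)) :
    Real.exp |w.im| ≤ 4 * ‖Complex.sin w‖ := by
  have h1 : (Complex.sin w).re = Real.sin w.re * Real.cosh w.im := by
    rw [Complex.sin_eq]
    simp [← Complex.ofReal_sin, ← Complex.ofReal_cosh, ← Complex.ofReal_cos, ← Complex.ofReal_sinh]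
  have h2 : |Real.sin w.re| = 1 := by
    have : w.re = k * π + π / 2 := by rw [hw]; ring
    rw [this, Real.sin_add_pi_div_two, Real.abs_cos_int_mul_pi]
  have h3 := Complex.abs_re_le_norm (Complex.sin w)
  rw [h1, abs_mul, h2, one_mul, abs_of_pos (Real.cosh_pos _), ← Real.cosh_abs, Real.cosh_eq] at h3
  have := Real.exp_pos (-|w.im|)
  have := Real.exp_pos (|w.im|)
  linarith

/-- The lower bounds on sine control `Q` for `|Im z| ≥ 1` and on the lines `Re z = k + 1/2`. Every
other point lies in a rectangle bounded by such lines, where the maximum principle applies. -/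
theorem norm_quotient_le {F Q : ℂ → ℂ} {M : ℝ}
    (hF : ∀ z, ‖F z‖ ≤ M * Real.exp (2 * π * |z.im|)) (hQ : Differentiable ℂ Q)
    (hFQ : ∀ z, F z = Q z * Complex.sin (π * z) ^ 2) (z : ℂ) : ‖Q z‖ ≤ 16 * M := by
  have hM : 0 ≤ M := by simpa using (norm_nonneg _).trans (hF 0)
  have hbase : ∀ z : ℂ, Real.exp |(π * z).im| ≤ 4 * ‖Complex.sin (π * z)‖ → ‖Q z‖ ≤ 16 * M := by
    intro z hz
    have him : |((π : ℂ) * z).im| = π * |z.im| := by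
      simp [abs_mul, abs_of_pos Real.pi_pos]
    rw [him] at hz
    have hpos : 0 < Real.exp (π * |z.im|) := Real.exp_pos _
    have h1 := hF z
    rw [hFQ, norm_mul, norm_pow] at h1
    have h2 : Real.exp (2 * π * |z.im|) = Real.exp (π * |z.im|) ^ 2 := by
      rw [← Real.exp_nat_mul]; push_cast; ring_nf
    rw [h2] at h1
    have h3 : Real.exp (π * |z.im|) ^ 2 ≤ 16 * ‖Complex.sin (π * z)‖ ^ 2 := by
      calc _ ≤ (4 * ‖Complex.sin (π * z)‖) ^ 2 := by gcongr
        _ = _ := by ring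
    have h4 : ‖Q z‖ * Real.exp (π * |z.im|) ^ 2 ≤ 16 * M * Real.exp (π * |z.im|) ^ 2 := by
      calc _ ≤ ‖Q z‖ * (16 * ‖Complex.sin (π * z)‖ ^ 2) := by gcongr
        _ = 16 * (‖Q z‖ * ‖Complex.sin (π * z)‖ ^ 2) := by ring
        _ ≤ 16 * (M * Real.exp (π * |z.im|) ^ 2) := by gcongr
        _ = _ := by ring
    exact le_of_mul_le_mul_right h4 (by positivity)
  have him : ∀ z : ℂ, 1 ≤ |z.im| → ‖Q z‖ ≤ 16 * M := by
    intro z hz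
    refine hbase z (exp_abs_im_le_norm_sin ?_)
    have : |((π : ℂ) * z).im| = π * |z.im| := by simp [abs_mul, abs_of_pos Real.pi_pos]
    rw [this]
    nlinarith [Real.pi_gt_three]
  have hre : ∀ (z : ℂ) (k : ℤ), z.re = k + 1 / 2 → ‖Q z‖ ≤ 16 * M := by
    intro z k hz
    refine hbase z (exp_abs_im_le_norm_sin_of_half (k := k) ?_)
    simp [hz]
  rcases le_or_gt 1 |z.im| with h | h
  · exact him z h
  · set k : ℤ := ⌊z.re - 1 / 2⌋ with hk
    have hk1 : (k : ℝ) + 1 / 2 ≤ z.re := by linarith [Int.floor_le (z.re - 1 / 2)]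
    have hk2 : z.re < k + 1 / 2 + 1 := by linarith [Int.lt_floor_add_one (z.re - 1 / 2)]
    let U : Set ℂ := Set.Ioo (k + 1 / 2 : ℝ) (k + 1 / 2 + 1) ×ℂ Set.Ioo (-1 : ℝ) 1
    have hU : Bornology.IsBounded U :=
      (Metric.isBounded_Ioo _ _).reProdIm (Metric.isBounded_Ioo _ _)
    have hcl : closure U = Set.Icc (k + 1 / 2 : ℝ) (k + 1 / 2 + 1) ×ℂ Set.Icc (-1 : ℝ) 1 := by
      rw [Complex.closure_reProdIm, closure_Ioo (by linarith), closure_Ioo (by norm_num)]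
    have hint : interior U = U :=
      (isOpen_Ioo.reProdIm isOpen_Ioo).interior_eq
    refine Complex.norm_le_of_forall_mem_frontier_norm_le hU hQ.diffContOnCl ?_ ?_
    · intro w hw
      rw [frontier, hint, hcl] at hw
      obtain ⟨⟨⟨hw1, hw2⟩, ⟨hw3, hw4⟩⟩, hw5⟩ := hw
      by_cases h1 : 1 ≤ |w.im|
      · exact him w h1
      · have h1' := abs_lt.1 (not_le.1 h1)
        rcases hw1.eq_or_lt with h2 | h2
        · exact hre w k h2.symm
        rcases hw2.eq_or_lt with h3 | h3
        · exact hre w (k + 1) (by rw [h3]; push_cast; ring)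
        · exact absurd ⟨⟨h2, h3⟩, h1'⟩ hw5
    · rw [hcl]
      have := abs_lt.1 h
      exact ⟨⟨hk1, hk2.le⟩, ⟨this.1.le, this.2.le⟩⟩

/-- A shift by `1/2` turns `sin²` into `cos²`, which equals `1` at every integer. The quadrature
inequality then bounds `N ‖q‖` by one fixed integral for all `N`. -/
theorem eq_zero_of_integrable_const_mul_sin_sq {q : ℂ}
    (h : Integrable fun x : ℝ => q * Complex.sin (π * x) ^ 2) : q = 0 := by
  have hi : Integrable fun x : ℝ => ((‖q‖ : ℝ) : ℂ) * Complex.cos (π * x) ^ 2 := by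
    have h1 := (h.norm.comp_add_right (1 / 2 : ℝ)).ofReal (𝕜 := ℂ)
    refine h1.congr (Eventually.of_forall fun x => ?_)
    have h2 : Complex.sin (π * ((x + 1 / 2 : ℝ) : ℂ)) = ((Real.cos (π * x) : ℝ) : ℂ) := by
      push_cast
      rw [show (π : ℂ) * (x + 1 / 2) = π * x + π / 2 by ring, Complex.sin_add_pi_div_two]
    have h3 : Complex.cos (π * x) = ((Real.cos (π * x) : ℝ) : ℂ) := by push_cast; rfl
    simp only [h2, h3, norm_mul, norm_pow, Complex.norm_real, Real.norm_eq_abs, sq_abs]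
    norm_cast
  have hcos : ∀ x : ℝ, Complex.cos (π * x) = ((Real.cos (π * x) : ℝ) : ℂ) := by
    intro x; push_cast; rfl
  have hre : ∀ x : ℝ, (((‖q‖ : ℝ) : ℂ) * Complex.cos (π * x) ^ 2).re =
      ‖q‖ * Real.cos (π * x) ^ 2 := by
    intro x
    rw [hcos, ← Complex.ofReal_pow, ← Complex.ofReal_mul, Complex.ofReal_re]
  have hb := sum_int_le_integral (G := fun z : ℂ => ((‖q‖ : ℝ) : ℂ) * Complex.cos (π * z) ^ 2)
    (M := ‖q‖) (by fun_prop) (fun z => ?_) (fun x => by rw [hre]; positivity) hi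
  · set I := ∫ x : ℝ, (((‖q‖ : ℝ) : ℂ) * Complex.cos (π * x) ^ 2).re
    by_contra hq
    have hq' : 0 < ‖q‖ := norm_pos_iff.2 hq
    obtain ⟨N, hN⟩ := exists_nat_gt (I / ‖q‖)
    have h1 := hb ((Finset.range N).map ⟨fun n : ℕ => (n : ℤ), Nat.cast_injective⟩)
    rw [Finset.sum_map] at h1
    have h2 : ∀ n ∈ Finset.range N,
        (((‖q‖ : ℝ) : ℂ) * Complex.cos (π * (((n : ℤ) : ℂ))) ^ 2).re = ‖q‖ := by
      intro n _
      have := hre (n : ℤ)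
      rw [Complex.ofReal_intCast] at this
      rw [this, mul_comm π, ← sq_abs, Real.abs_cos_int_mul_pi]
      simp
    simp only [Function.Embedding.coeFn_mk] at h1
    rw [Finset.sum_congr rfl h2] at h1
    simp only [Finset.sum_const, Finset.card_range, nsmul_eq_mul] at h1
    rw [div_lt_iff₀ hq'] at hN
    linarith
  · rw [norm_mul, Complex.norm_real, norm_norm, norm_pow]
    gcongr
    have := norm_cos_le_exp_abs_im (π * z)
    have him : |((π : ℂ) * z).im| = π * |z.im| := by simp [abs_mul, abs_of_pos Real.pi_pos]
    rw [him] at this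
    calc _ ≤ Real.exp (π * |z.im|) ^ 2 := by gcongr
      _ = _ := by rw [← Real.exp_nat_mul]; push_cast; ring_nf

/-- An integrable entire function of exponential type `2π` with double zeros at the integers
vanishes. -/
theorem eq_zero_of_double_zeros {F : ℂ → ℂ} {M : ℝ} (hd : Differentiable ℂ F)
    (hF : ∀ z, ‖F z‖ ≤ M * Real.exp (2 * π * |z.im|)) (hi : Integrable fun x : ℝ => F x)
    (h0 : ∀ n : ℤ, F n = 0) (h1 : ∀ n : ℤ, deriv F n = 0) (z : ℂ) : F z = 0 := by
  obtain ⟨Q, hQ, hFQ⟩ := exists_entire_quotient_sq (s := fun z => Complex.sin (π * z)) hd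
    (by fun_prop) (fun z hz => by
      obtain ⟨k, hk⟩ := Complex.sin_eq_zero_iff.1 hz
      have hzk : z = k := by
        have : (π : ℂ) ≠ 0 := Complex.ofReal_ne_zero.2 Real.pi_ne_zero
        exact mul_left_cancel₀ this (by rw [hk]; ring)
      refine ⟨hzk ▸ h0 k, hzk ▸ h1 k, ?_⟩
      have hder : HasDerivAt (fun z : ℂ => Complex.sin (π * z)) (Complex.cos (π * z) * π) z := by
        simpa using ((hasDerivAt_id z).const_mul (π : ℂ)).csin
      rw [hder.deriv]
      refine mul_ne_zero (fun hc => ?_) (Complex.ofReal_ne_zero.2 Real.pi_ne_zero)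
      have := Complex.sin_sq_add_cos_sq (π * z)
      rw [hz, hc] at this
      norm_num at this)
  have hb : Bornology.IsBounded (Set.range Q) :=
    isBounded_iff_forall_norm_le.2 ⟨16 * M, by
      rintro _ ⟨z, rfl⟩; exact norm_quotient_le hF hQ hFQ z⟩
  have hconst : ∀ z, Q z = Q 0 := fun z => hQ.apply_eq_apply_of_bounded hb z 0
  have hq : Q 0 = 0 := eq_zero_of_integrable_const_mul_sin_sq
    (hi.congr (Eventually.of_forall fun x => by simp only [hFQ]; rw [hconst]))
  rw [hFQ, hconst, hq, zero_mul]

end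

/-! ### The extremal functions: closed form, one-sided approximation, size -/

noncomputable section

/-- The common shape of the extremal functions, with normalizing constant `κ`. -/
def poissonExtremal (β Δ κ : ℝ) (z : ℂ) : ℂ :=
  ((β * (π * Δ) ^ 2 / κ : ℝ) : ℂ) * (csinc (((π * Δ : ℝ) : ℂ) * (z + β * Complex.I)) *
    csinc (((π * Δ : ℝ) : ℂ) * (z - β * Complex.I)))

section
variable {β Δ κ : ℝ}

theorem differentiable_poissonExtremal : Differentiable ℂ (poissonExtremal β Δ κ) := by
  have := differentiable_csinc
  unfold poissonExtremal
  fun_prop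

theorem poissonExtremal_neg (z : ℂ) : poissonExtremal β Δ κ (-z) = poissonExtremal β Δ κ z := by
  unfold poissonExtremal
  rw [mul_comm (csinc (((π * Δ : ℝ) : ℂ) * (z + β * Complex.I))),
    ← csinc_neg (((π * Δ : ℝ) : ℂ) * (z - β * Complex.I)),
    ← csinc_neg (((π * Δ : ℝ) : ℂ) * (z + β * Complex.I))]
  ring_nf

/-- Product-to-sum for `sin(πΔ(z + iβ)) sin(πΔ(z - iβ))`, together with `(z + iβ)(z - iβ) = z² +
β²`. The sinc product has the removable singularities filled in. -/
theorem mul_poissonExtremal (z : ℂ) :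
    ((β : ℂ) ^ 2 + z ^ 2) * poissonExtremal β Δ κ z =
      β / (2 * κ) * (Complex.cosh (2 * π * β * Δ) - Complex.cos (2 * π * Δ * z)) := by
  set u : ℂ := ((π * Δ : ℝ) : ℂ) with hu
  have h1 := mul_csinc (u * (z + β * Complex.I))
  have h2 := mul_csinc (u * (z - β * Complex.I))
  have h3 : Complex.sin (u * (z + β * Complex.I)) * Complex.sin (u * (z - β * Complex.I)) =
      (Complex.cosh (2 * π * β * Δ) - Complex.cos (2 * π * Δ * z)) / 2 := by
    have e1 : Complex.cosh (2 * π * β * Δ) =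
        Complex.cos (u * (z + β * Complex.I) - u * (z - β * Complex.I)) := by
      rw [← Complex.cos_mul_I, hu]; push_cast; ring_nf
    have e2 : Complex.cos (2 * π * Δ * z) =
        Complex.cos (u * (z + β * Complex.I) + u * (z - β * Complex.I)) := by
      rw [hu]; push_cast; ring_nf
    rw [e1, e2, Complex.cos_sub, Complex.cos_add]
    ring
  have h4 : (β : ℂ) ^ 2 + z ^ 2 = (z + β * Complex.I) * (z - β * Complex.I) := by
    linear_combination ((β : ℂ) ^ 2) * Complex.I_sq
  have h5 : ((β * (π * Δ) ^ 2 / κ : ℝ) : ℂ) = β / κ * u ^ 2 := by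
    rw [hu]; push_cast; ring
  rw [poissonExtremal, h4, h5]
  calc _ = β / κ * ((u * (z + β * Complex.I) * csinc (u * (z + β * Complex.I))) *
        (u * (z - β * Complex.I) * csinc (u * (z - β * Complex.I)))) := by ring
    _ = _ := by rw [h1, h2, h3]; ring

theorem poissonExtremal_ofReal (hβ : 0 < β) (x : ℝ) :
    poissonExtremal β Δ κ x = ((linePoissonKernel β x * ((Real.cosh (2 * π * β * Δ) -
      Real.cos (2 * π * Δ * x)) / (2 * κ)) : ℝ) : ℂ) := by
  have h := mul_poissonExtremal (β := β) (Δ := Δ) (κ := κ) x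
  have h0 : (0 : ℝ) < β ^ 2 + x ^ 2 := by positivity
  have h1 : (β : ℂ) ^ 2 + (x : ℂ) ^ 2 ≠ 0 := by exact_mod_cast h0.ne'
  refine mul_left_cancel₀ h1 ?_
  rw [h, linePoissonKernel]
  push_cast
  rw [div_mul_eq_mul_div, div_mul_eq_mul_div, mul_div_cancel₀ _ h1]
  ring

theorem isRealEntire_poissonExtremal (hβ : 0 < β) : IsRealEntire (poissonExtremal β Δ κ) :=
  ⟨differentiable_poissonExtremal, fun x => by
    rw [poissonExtremal_ofReal hβ, Complex.ofReal_im]⟩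

/-- `cosh 2a - cos 2b = 2 sinh² a + 2 sin² b`. This form shows the majorant property and the contact
points, the zeros of the sine. -/
theorem poissonExtremal_majorant_re (hβ : 0 < β) (hΔ : 0 < Δ) (x : ℝ) :
    (poissonExtremal β Δ (Real.sinh (π * β * Δ) ^ 2) x).re = linePoissonKernel β x *
      (1 + Real.sin (π * Δ * x) ^ 2 / Real.sinh (π * β * Δ) ^ 2) := by
  rw [poissonExtremal_ofReal hβ, Complex.ofReal_re]
  have hs : Real.sinh (π * β * Δ) ≠ 0 := (Real.sinh_pos_iff.2 (by positivity)).ne'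
  rw [show 2 * π * β * Δ = 2 * (π * β * Δ) by ring, show 2 * π * Δ * x = 2 * (π * Δ * x) by ring,
    Real.cosh_two_mul, Real.cos_two_mul, Real.cosh_sq, Real.sin_sq]
  field_simp
  ring

/-- The same quantity also equals `2 cosh² a - 2 cos² b`. -/
theorem poissonExtremal_minorant_re (hβ : 0 < β) (x : ℝ) :
    (poissonExtremal β Δ (Real.cosh (π * β * Δ) ^ 2) x).re = linePoissonKernel β x *
      (1 - Real.cos (π * Δ * x) ^ 2 / Real.cosh (π * β * Δ) ^ 2) := by
  rw [poissonExtremal_ofReal hβ, Complex.ofReal_re]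
  have hs : Real.cosh (π * β * Δ) ≠ 0 := (Real.cosh_pos _).ne'
  rw [show 2 * π * β * Δ = 2 * (π * β * Δ) by ring, show 2 * π * Δ * x = 2 * (π * Δ * x) by ring,
    Real.cosh_two_mul, Real.cos_two_mul, Real.sinh_sq]
  field_simp
  ring

theorem linePoissonKernel_pos (hβ : 0 < β) (x : ℝ) : 0 < linePoissonKernel β x := by
  unfold linePoissonKernel; positivity

theorem linePoissonKernel_le_majorant (hβ : 0 < β) (hΔ : 0 < Δ) (x : ℝ) :
    linePoissonKernel β x ≤ (poissonExtremal β Δ (Real.sinh (π * β * Δ) ^ 2) x).re := by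
  rw [poissonExtremal_majorant_re hβ hΔ]
  refine le_mul_of_one_le_right (linePoissonKernel_pos hβ x).le ?_
  have : 0 ≤ Real.sin (π * Δ * x) ^ 2 / Real.sinh (π * β * Δ) ^ 2 := by positivity
  linarith

theorem minorant_le_linePoissonKernel (hβ : 0 < β) (x : ℝ) :
    (poissonExtremal β Δ (Real.cosh (π * β * Δ) ^ 2) x).re ≤ linePoissonKernel β x := by
  rw [poissonExtremal_minorant_re hβ]
  refine mul_le_of_le_one_right (linePoissonKernel_pos hβ x).le ?_
  have : 0 ≤ Real.cos (π * Δ * x) ^ 2 / Real.cosh (π * β * Δ) ^ 2 := by positivity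
  linarith

theorem minorant_pos (hβ : 0 < β) (hΔ : 0 < Δ) (x : ℝ) :
    0 < (poissonExtremal β Δ (Real.cosh (π * β * Δ) ^ 2) x).re := by
  rw [poissonExtremal_minorant_re hβ]
  refine mul_pos (linePoissonKernel_pos hβ x) (sub_pos.2 ?_)
  have h1 : 1 < Real.cosh (π * β * Δ) := Real.one_lt_cosh.2 (by positivity)
  rw [div_lt_one (by positivity)]
  nlinarith [Real.cos_sq_le_one (π * Δ * x)]

/-- The free denominator `D` serves both for linear decay in `‖z‖`, uniform in `β`, and for
quadratic decay in `Re z`. -/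
theorem norm_poissonExtremal_le (hβ : 0 < β) (hΔ : 0 < Δ) (hκ : 0 < κ) (z : ℂ) {D : ℝ}
    (hD : 0 < D)
    (hDz : D ≤ (1 + π * Δ * ‖z + β * Complex.I‖) * (1 + π * Δ * ‖z - β * Complex.I‖)) :
    ‖poissonExtremal β Δ κ z‖ ≤ 4 * β * (π * Δ) ^ 2 * Real.exp (π * β * Δ) ^ 2 / κ *
      Real.exp (2 * π * Δ * |z.im|) / D := by
  have hu : 0 < π * Δ := by positivity
  have h1 : ‖csinc (((π * Δ : ℝ) : ℂ) * (z + β * Complex.I))‖ ≤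
      2 * Real.exp (π * Δ * (|z.im| + β)) / (1 + π * Δ * ‖z + β * Complex.I‖) := by
    refine (norm_csinc_le_div _).trans ?_
    rw [norm_mul, Complex.norm_real, Real.norm_eq_abs, abs_of_pos hu, Complex.im_ofReal_mul,
      abs_mul, abs_of_pos hu]
    gcongr
    have : (z + β * Complex.I).im = z.im + β := by simp
    rw [this]
    exact (abs_add_le _ _).trans_eq (by rw [abs_of_pos hβ])
  have h2 : ‖csinc (((π * Δ : ℝ) : ℂ) * (z - β * Complex.I))‖ ≤
      2 * Real.exp (π * Δ * (|z.im| + β)) / (1 + π * Δ * ‖z - β * Complex.I‖) := by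
    refine (norm_csinc_le_div _).trans ?_
    rw [norm_mul, Complex.norm_real, Real.norm_eq_abs, abs_of_pos hu, Complex.im_ofReal_mul,
      abs_mul, abs_of_pos hu]
    gcongr
    have : (z - β * Complex.I).im = z.im - β := by simp
    rw [this]
    exact (abs_sub _ _).trans_eq (by rw [abs_of_pos hβ])
  have h3 : Real.exp (π * Δ * (|z.im| + β)) ^ 2 =
      Real.exp (π * β * Δ) ^ 2 * Real.exp (2 * π * Δ * |z.im|) := by
    simp only [← Real.exp_nat_mul, ← Real.exp_add]
    congr 1
    push_cast
    ring
  have hc : 0 < β * (π * Δ) ^ 2 / κ := by positivity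
  rw [poissonExtremal, norm_mul, norm_mul, Complex.norm_real, Real.norm_eq_abs, abs_of_pos hc]
  calc _ ≤ β * (π * Δ) ^ 2 / κ *
        (2 * Real.exp (π * Δ * (|z.im| + β)) / (1 + π * Δ * ‖z + β * Complex.I‖) *
        (2 * Real.exp (π * Δ * (|z.im| + β)) / (1 + π * Δ * ‖z - β * Complex.I‖))) := by gcongr
    _ = 4 * β * (π * Δ) ^ 2 / κ * (Real.exp (π * Δ * (|z.im| + β)) ^ 2 /
        ((1 + π * Δ * ‖z + β * Complex.I‖) * (1 + π * Δ * ‖z - β * Complex.I‖))) := by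
        rw [div_mul_div_comm]; ring
    _ ≤ 4 * β * (π * Δ) ^ 2 / κ * (Real.exp (π * Δ * (|z.im| + β)) ^ 2 / D) := by gcongr
    _ = _ := by rw [h3]; ring

/-- The linear terms of the product suffice, as `2‖z‖ ≤ ‖z + iβ‖ + ‖z - iβ‖`. At `z = iβ` one factor
is `1`, so nothing better than linear is uniform in `β`. -/
theorem norm_poissonExtremal_le_div_norm (hβ : 0 < β) (hΔ : 0 < Δ) (hκ : 0 < κ) (z : ℂ) :
    ‖poissonExtremal β Δ κ z‖ ≤ 4 * β * (π * Δ) ^ 2 * Real.exp (π * β * Δ) ^ 2 / κ *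
      Real.exp (2 * π * Δ * |z.im|) / (1 + Δ * ‖z‖) := by
  refine norm_poissonExtremal_le hβ hΔ hκ z (by positivity) ?_
  have h1 : 2 * ‖z‖ ≤ ‖z + β * Complex.I‖ + ‖z - β * Complex.I‖ := by
    calc 2 * ‖z‖ = ‖(z + β * Complex.I) + (z - β * Complex.I)‖ := by
          rw [show (z + β * Complex.I) + (z - β * Complex.I) = 2 * z by ring, norm_mul,
            Complex.norm_ofNat]
      _ ≤ _ := norm_add_le _ _
  have h2 := Real.pi_gt_three
  set A := ‖z + β * Complex.I‖
  set B := ‖z - β * Complex.I‖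
  have hA : 0 ≤ A := norm_nonneg _
  have hB : 0 ≤ B := norm_nonneg _
  have h3 : 0 ≤ (π * Δ * A) * (π * Δ * B) := by positivity
  have h4 : Δ * ‖z‖ ≤ π * Δ * (A + B) := by
    calc Δ * ‖z‖ ≤ Δ * (A + B) := by gcongr; linarith [norm_nonneg z]
      _ ≤ π * Δ * (A + B) := by
        rw [mul_assoc]
        exact le_mul_of_one_le_left (by positivity) (by linarith)
  linarith

theorem norm_poissonExtremal_le_div_re (hβ : 0 < β) (hΔ : 0 < Δ) (hκ : 0 < κ) (z : ℂ) :
    ‖poissonExtremal β Δ κ z‖ ≤ 4 * β * (π * Δ) ^ 2 * Real.exp (π * β * Δ) ^ 2 / κ *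
      Real.exp (2 * π * Δ * |z.im|) / (1 + (π * Δ * z.re) ^ 2) := by
  refine norm_poissonExtremal_le hβ hΔ hκ z (by positivity) ?_
  have h1 : |z.re| ≤ ‖z + β * Complex.I‖ := by
    simpa using Complex.abs_re_le_norm (z + β * Complex.I)
  have h2 : |z.re| ≤ ‖z - β * Complex.I‖ := by
    simpa using Complex.abs_re_le_norm (z - β * Complex.I)
  calc 1 + (π * Δ * z.re) ^ 2 = 1 + (π * Δ) ^ 2 * |z.re| ^ 2 := by rw [sq_abs]; ring
    _ ≤ (1 + π * Δ * |z.re|) * (1 + π * Δ * |z.re|) := by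
        have : 0 ≤ π * Δ * |z.re| := by positivity
        linarith
    _ ≤ _ := by gcongr

theorem norm_poissonExtremal_le_exp (hβ : 0 < β) (hΔ : 0 < Δ) (hκ : 0 < κ) (z : ℂ) :
    ‖poissonExtremal β Δ κ z‖ ≤ 4 * β * (π * Δ) ^ 2 * Real.exp (π * β * Δ) ^ 2 / κ *
      Real.exp (2 * π * Δ * |z.im|) := by
  refine (norm_poissonExtremal_le_div_re hβ hΔ hκ z).trans (div_le_self (by positivity) ?_)
  linarith [sq_nonneg (π * Δ * z.re)]

theorem hasExponentialType_poissonExtremal (hβ : 0 < β) (hΔ : 0 < Δ) (hκ : 0 < κ) :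
    HasExponentialType (2 * π * Δ) (poissonExtremal β Δ κ) := by
  refine hasExponentialType_of_norm_le
    (C := 4 * β * (π * Δ) ^ 2 * Real.exp (π * β * Δ) ^ 2 / κ) fun z => ?_
  refine (norm_poissonExtremal_le_exp hβ hΔ hκ z).trans ?_
  gcongr
  exact Complex.abs_im_le_norm z

theorem quadDecay_poissonExtremal (hβ : 0 < β) (hΔ : 0 < Δ) (hκ : 0 < κ) (t : ℝ) :
    QuadDecay (fun z => poissonExtremal β Δ κ (t + z / Δ))
      (4 * β * (π * Δ) ^ 2 * Real.exp (π * β * Δ) ^ 2 / κ * (3 + 2 * (Δ * t) ^ 2)) 1 where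
  diff := by
    have := differentiable_poissonExtremal (β := β) (Δ := Δ) (κ := κ)
    fun_prop
  pos := one_pos
  bound z := by
    refine (norm_poissonExtremal_le_div_re hβ hΔ hκ _).trans ?_
    have h1 : ((t : ℂ) + z / Δ).re = t + z.re / Δ := by simp
    have h2 : ((t : ℂ) + z / Δ).im = z.im / Δ := by simp
    rw [h1, h2, abs_div, abs_of_pos hΔ, show 2 * π * Δ * (|z.im| / Δ) = 2 * π * |z.im| by field_simp,
      show π * Δ * (t + z.re / Δ) = π * (Δ * t + z.re) by field_simp, one_mul]
    set C := 4 * β * (π * Δ) ^ 2 * Real.exp (π * β * Δ) ^ 2 / κ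
    have hC : 0 ≤ C := by positivity
    set u := Δ * t
    rw [div_le_div_iff₀ (by positivity) (by positivity)]
    -- Since `y² ≤ 2u² + 2(u + y)²`, the factor `3 + 2u²` pays for translating the decay.
    have h3 : 1 + z.re ^ 2 ≤ (3 + 2 * u ^ 2) * (1 + (π * (u + z.re)) ^ 2) := by
      have h4 : (u + z.re) ^ 2 ≤ (π * (u + z.re)) ^ 2 := by
        rw [mul_pow]
        exact le_mul_of_one_le_left (sq_nonneg _) (by nlinarith [Real.pi_gt_three])
      nlinarith [sq_nonneg (2 * u + z.re), mul_nonneg (sq_nonneg u) (sq_nonneg (π * (u + z.re)))]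
    calc C * Real.exp (2 * π * |z.im|) * (1 + z.re ^ 2)
        ≤ C * Real.exp (2 * π * |z.im|) * ((3 + 2 * u ^ 2) * (1 + (π * (u + z.re)) ^ 2)) := by
          gcongr
      _ = _ := by ring

theorem integrable_poissonExtremal (hβ : 0 < β) (hΔ : 0 < Δ) (hκ : 0 < κ) :
    Integrable fun x : ℝ => poissonExtremal β Δ κ x := by
  have h := (quadDecay_poissonExtremal hβ hΔ hκ 0).integrable
  have h2 := h.comp_mul_left' hΔ.ne'
  refine h2.congr (Eventually.of_forall fun x => ?_)
  have : (Δ : ℂ) ≠ 0 := Complex.ofReal_ne_zero.2 hΔ.ne'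
  simp only [Complex.ofReal_zero, zero_add, Complex.ofReal_mul]
  rw [mul_div_cancel_left₀ _ this]

theorem majorant_le_bound (hβ : 0 < β) (hβ' : β ≤ 1 / 2) (hΔ : 1 ≤ Δ) (x : ℝ) :
    (poissonExtremal β Δ (Real.sinh (π * β * Δ) ^ 2) x).re ≤ 3 * (1 / (β * (1 + x ^ 2))) := by
  have hΔ0 : 0 < Δ := by linarith
  rw [poissonExtremal_majorant_re hβ hΔ0, linePoissonKernel]
  have ha : 0 < π * β * Δ := by positivity
  have hsa : π * β * Δ ≤ Real.sinh (π * β * Δ) := Real.self_le_sinh_iff.2 ha.le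
  set s := Real.sinh (π * β * Δ)
  have hs : 0 < s := ha.trans_le hsa
  have hs2 : (π * β * Δ) ^ 2 ≤ s ^ 2 := by gcongr
  have hβs : β ^ 2 ≤ s ^ 2 := by
    refine le_trans ?_ hs2
    have : β ≤ π * β * Δ := by nlinarith [Real.pi_gt_three, mul_pos hβ hΔ0]
    gcongr
  have hsin1 : Real.sin (π * Δ * x) ^ 2 ≤ 1 := Real.sin_sq_le_one _
  have hsin2 : Real.sin (π * Δ * x) ^ 2 ≤ (π * Δ * x) ^ 2 := by
    rw [sq_le_sq]; exact Real.abs_sin_le_abs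
  set q := Real.sin (π * Δ * x) ^ 2
  have hq : 0 ≤ q := sq_nonneg _
  -- After cross-multiplication three terms must be at most `s² x²` each, whence the `3`. This one
  -- uses `|sin v| ≤ |v|`, the next `sin² ≤ 1`, the last `β ≤ 1`.
  have h1 : β ^ 2 * q ≤ s ^ 2 * x ^ 2 := by
    calc β ^ 2 * q ≤ β ^ 2 * (π * Δ * x) ^ 2 := by gcongr
      _ = (π * β * Δ) ^ 2 * x ^ 2 := by ring
      _ ≤ _ := by gcongr
  have h2 : β ^ 2 * x ^ 2 * q ≤ s ^ 2 * x ^ 2 := by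
    calc β ^ 2 * x ^ 2 * q ≤ s ^ 2 * x ^ 2 * 1 := by gcongr
      _ = _ := mul_one _
  have h3 : β ^ 2 * x ^ 2 * s ^ 2 ≤ x ^ 2 * s ^ 2 := by
    have : β ^ 2 ≤ 1 := by nlinarith
    calc _ ≤ 1 * x ^ 2 * s ^ 2 := by gcongr
      _ = _ := by ring
  have h4 : 0 ≤ β ^ 2 * s ^ 2 := by positivity
  have e : β / (β ^ 2 + x ^ 2) * (1 + q / s ^ 2) =
      (β * (s ^ 2 + q)) / ((β ^ 2 + x ^ 2) * s ^ 2) := by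
    field_simp
  rw [e, mul_one_div, div_le_div_iff₀ (by positivity) (by positivity)]
  nlinarith

theorem norm_majorant_le (hβ : 0 < β) (hβ' : β ≤ 1 / 2) (hΔ : 1 ≤ Δ) (z : ℂ) :
    ‖poissonExtremal β Δ (Real.sinh (π * β * Δ) ^ 2) z‖ ≤ 16 * π ^ 2 *
      (Δ ^ 2 * Real.exp (2 * π * Δ * |z.im|) / (β * (1 + Δ * ‖z‖))) := by
  have hΔ0 : 0 < Δ := by linarith
  have ha : 0 < π * β * Δ := by positivity
  have hs : 0 < Real.sinh (π * β * Δ) := Real.sinh_pos_iff.2 ha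
  refine (norm_poissonExtremal_le_div_norm hβ hΔ0 (by positivity) z).trans ?_
  -- With `a = πβΔ`, `exp (2a) ≥ 1 + 2a` yields `a exp a ≤ (1 + 2a) sinh a`, and `1 + 2a ≤ 2πΔ`
  -- because `β ≤ 1/2` and `πΔ ≥ 1`.
  have key : β * Real.exp (π * β * Δ) ≤ 2 * Real.sinh (π * β * Δ) := by
    have h1 : (π * β * Δ) * Real.exp (π * β * Δ) ≤
        (1 + 2 * (π * β * Δ)) * Real.sinh (π * β * Δ) := by
      set a := π * β * Δ
      rw [Real.sinh_eq]
      have h2 := Real.add_one_le_exp (2 * a)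
      have h3 : Real.exp (-a) * Real.exp (2 * a) = Real.exp a := by rw [← Real.exp_add]; ring_nf
      have h4 := mul_le_mul_of_nonneg_left h2 (Real.exp_pos (-a)).le
      rw [h3] at h4
      linarith
    have h5 : (π * Δ) * (β * Real.exp (π * β * Δ)) ≤ (π * Δ) * (2 * Real.sinh (π * β * Δ)) := by
      calc _ = (π * β * Δ) * Real.exp (π * β * Δ) := by ring
        _ ≤ (1 + 2 * (π * β * Δ)) * Real.sinh (π * β * Δ) := h1
        _ ≤ (2 * (π * Δ)) * Real.sinh (π * β * Δ) := by
            gcongr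
            have : 0 < π * Δ := by positivity
            nlinarith [Real.pi_gt_three]
        _ = _ := by ring
    exact le_of_mul_le_mul_left h5 (by positivity)
  set s := Real.sinh (π * β * Δ)
  set e := Real.exp (π * β * Δ)
  have he : 0 < e := Real.exp_pos _
  have h6 : β ^ 2 * e ^ 2 / s ^ 2 ≤ 4 := by
    rw [div_le_iff₀ (by positivity)]
    calc β ^ 2 * e ^ 2 = (β * e) ^ 2 := by ring
      _ ≤ (2 * s) ^ 2 := by gcongr
      _ = _ := by ring
  calc _ = 4 * π ^ 2 * (β ^ 2 * e ^ 2 / s ^ 2) *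
        (Δ ^ 2 * Real.exp (2 * π * Δ * |z.im|) / (β * (1 + Δ * ‖z‖))) := by
        field_simp
    _ ≤ 4 * π ^ 2 * 4 * (Δ ^ 2 * Real.exp (2 * π * Δ * |z.im|) / (β * (1 + Δ * ‖z‖))) := by gcongr
    _ = _ := by ring

theorem norm_minorant_le (hβ : 0 < β) (hΔ : 0 < Δ) (z : ℂ) :
    ‖poissonExtremal β Δ (Real.cosh (π * β * Δ) ^ 2) z‖ ≤ 16 * π ^ 2 *
      (β * Δ ^ 2 * Real.exp (2 * π * Δ * |z.im|) / (1 + Δ * ‖z‖)) := by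
  have hs : 0 < Real.cosh (π * β * Δ) := Real.cosh_pos _
  refine (norm_poissonExtremal_le_div_norm hβ hΔ (by positivity) z).trans ?_
  have key : Real.exp (π * β * Δ) ≤ 2 * Real.cosh (π * β * Δ) := by
    rw [Real.cosh_eq]; linarith [Real.exp_pos (-(π * β * Δ))]
  set s := Real.cosh (π * β * Δ)
  set e := Real.exp (π * β * Δ)
  have he : 0 < e := Real.exp_pos _
  have h6 : e ^ 2 / s ^ 2 ≤ 4 := by
    rw [div_le_iff₀ (by positivity)]
    calc e ^ 2 ≤ (2 * s) ^ 2 := by gcongr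
      _ = _ := by ring
  calc _ = 4 * π ^ 2 * (e ^ 2 / s ^ 2) *
        (β * Δ ^ 2 * Real.exp (2 * π * Δ * |z.im|) / (1 + Δ * ‖z‖)) := by
        field_simp
    _ ≤ 4 * π ^ 2 * 4 * (β * Δ ^ 2 * Real.exp (2 * π * Δ * |z.im|) / (1 + Δ * ‖z‖)) := by gcongr
    _ = _ := by ring

end
end

/-! ### Fourier transforms -/

noncomputable section

theorem continuous_fourier_of_integrable {f : ℝ → ℂ} (hf : Integrable f) : Continuous (𝓕 f) :=
  VectorFourier.fourierIntegral_continuous Real.continuous_fourierChar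
    (by exact continuous_inner) hf

theorem fourier_zero_eq_integral (f : ℝ → ℂ) : 𝓕 f 0 = ∫ x : ℝ, f x := by
  rw [Real.fourier_real_eq_integral_exp_smul]; simp

section
variable {β Δ κ : ℝ}

theorem integrable_linePoissonKernel (hβ : 0 < β) : Integrable (linePoissonKernel β) := by
  have h := (integrable_div_one_add_mul_sq β⁻¹ (inv_pos.2 hβ))
  refine h.congr (Eventually.of_forall fun x => ?_)
  have h0 : (0 : ℝ) < β ^ 2 + x ^ 2 := by positivity
  simp only [linePoissonKernel]
  field_simp

theorem hasIntegral_exp_abs (hβ : 0 < β) (ξ : ℝ) :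
    Integrable (fun x : ℝ => Complex.exp (((-2 * π * x * ξ : ℝ) : ℂ) * Complex.I) •
      ((Real.exp (-(2 * π * β) * |x|) : ℝ) : ℂ)) ∧
    ∫ x : ℝ, Complex.exp (((-2 * π * x * ξ : ℝ) : ℂ) * Complex.I) •
      ((Real.exp (-(2 * π * β) * |x|) : ℝ) : ℂ) = ((linePoissonKernel β ξ / π : ℝ) : ℂ) := by
  have hb : 0 < 2 * π * β := by positivity
  set f : ℝ → ℂ := fun x => Complex.exp (((-2 * π * x * ξ : ℝ) : ℂ) * Complex.I) •
      ((Real.exp (-(2 * π * β) * |x|) : ℝ) : ℂ) with hf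
  set a : ℂ := 2 * π * β - 2 * π * ξ * Complex.I with ha
  set b : ℂ := -(2 * π * β) - 2 * π * ξ * Complex.I with hbd
  have hare : 0 < a.re := by simpa [ha] using hb
  have hbre : b.re < 0 := by simpa [hbd] using hb
  have h1 : Set.EqOn f (fun x : ℝ => Complex.exp (a * x)) (Set.Iic 0) := by
    intro x hx
    simp only [hf, abs_of_nonpos (Set.mem_Iic.1 hx), smul_eq_mul]
    push_cast
    rw [← Complex.exp_add, ha]
    ring_nf
  have h2 : Set.EqOn f (fun x : ℝ => Complex.exp (b * x)) (Set.Ioi 0) := by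
    intro x hx
    simp only [hf, abs_of_pos (Set.mem_Ioi.1 hx), smul_eq_mul]
    push_cast
    rw [← Complex.exp_add, hbd]
    ring_nf
  have i1 : IntegrableOn f (Set.Iic 0) :=
    (integrableOn_exp_mul_complex_Iic hare 0).congr_fun h1.symm measurableSet_Iic
  have i2 : IntegrableOn f (Set.Ioi 0) :=
    (integrableOn_exp_mul_complex_Ioi hbre 0).congr_fun h2.symm measurableSet_Ioi
  refine ⟨?_, ?_⟩
  · rw [← integrableOn_univ, ← Set.Iic_union_Ioi (a := (0 : ℝ))]
    exact i1.union i2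
  · rw [← intervalIntegral.integral_Iic_add_Ioi i1 i2, setIntegral_congr_fun measurableSet_Iic h1,
      setIntegral_congr_fun measurableSet_Ioi h2, integral_exp_mul_complex_Iic hare,
      integral_exp_mul_complex_Ioi hbre]
    have ha0 : a ≠ 0 := fun h => by simp [h] at hare
    have hb0 : b ≠ 0 := fun h => by simp [h] at hbre
    have hpi : (π : ℂ) ≠ 0 := Complex.ofReal_ne_zero.2 Real.pi_ne_zero
    have h3 : (β : ℂ) ^ 2 + (ξ : ℂ) ^ 2 ≠ 0 := by
      have : (0 : ℝ) < β ^ 2 + ξ ^ 2 := by positivity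
      exact_mod_cast this.ne'
    have hab : a * b = -(4 * π ^ 2 * ((β : ℂ) ^ 2 + (ξ : ℂ) ^ 2)) := by
      rw [ha, hbd]
      linear_combination (4 * (π : ℂ) ^ 2 * ξ ^ 2) * Complex.I_sq
    have hsub : b - a = -(4 * π * β) := by rw [ha, hbd]; ring
    simp only [Complex.ofReal_zero, mul_zero, Complex.exp_zero]
    rw [show (1 : ℂ) / a + -1 / b = (b - a) / (a * b) by field_simp; ring, hab, hsub,
      linePoissonKernel]
    push_cast
    field_simp

/-- The transform of `exp (-2πβ|x|)` is elementary and equals `h_β / π`; Fourier inversion gives the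
reverse direction. -/
theorem fourier_linePoissonKernel (hβ : 0 < β) (ξ : ℝ) :
    𝓕 (fun x : ℝ => (linePoissonKernel β x : ℂ)) ξ =
      ((π * Real.exp (-(2 * π * β) * |ξ|) : ℝ) : ℂ) := by
  let f : ℝ → ℂ := fun x => ((Real.exp (-(2 * π * β) * |x|) : ℝ) : ℂ)
  have hf : Integrable f := by simpa [f] using (hasIntegral_exp_abs hβ 0).1
  have hF : 𝓕 f = fun ξ : ℝ => ((linePoissonKernel β ξ / π : ℝ) : ℂ) := by
    funext ξ
    rw [Real.fourier_real_eq_integral_exp_smul]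
    exact (hasIntegral_exp_abs hβ ξ).2
  have hFi : Integrable (𝓕 f) := by
    rw [hF]; exact ((integrable_linePoissonKernel hβ).div_const π).ofReal
  have hc : Continuous f := by fun_prop
  have hinv := congrFun (hc.fourierInv_fourier_eq hf hFi) (-ξ)
  rw [Real.fourierInv_eq_fourier_neg, neg_neg, hF] at hinv
  have hpi : (π : ℂ) ≠ 0 := Complex.ofReal_ne_zero.2 Real.pi_ne_zero
  rw [Real.fourier_real_eq_integral_exp_smul] at hinv ⊢
  have h1 : ∀ x : ℝ, Complex.exp (((-2 * π * x * ξ : ℝ) : ℂ) * Complex.I) •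
      (linePoissonKernel β x : ℂ) = π * (Complex.exp (((-2 * π * x * ξ : ℝ) : ℂ) * Complex.I) •
        ((linePoissonKernel β x / π : ℝ) : ℂ)) := by
    intro x
    rw [Complex.ofReal_div, smul_eq_mul, smul_eq_mul, mul_left_comm, mul_div_cancel₀ _ hpi]
  rw [integral_congr_ae (Eventually.of_forall h1), integral_const_mul, hinv]
  simp [f]

theorem integral_linePoissonKernel (hβ : 0 < β) : ∫ x : ℝ, linePoissonKernel β x = π := by
  have h := fourier_linePoissonKernel hβ 0
  rw [fourier_zero_eq_integral, integral_complex_ofReal] at h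
  have h' := Complex.ofReal_injective h
  simpa using h'

theorem integrable_exp_smul {f : ℝ → ℂ} (hf : Integrable f) (ξ : ℝ) :
    Integrable fun x : ℝ => Complex.exp (((-2 * π * x * ξ : ℝ) : ℂ) * Complex.I) • f x := by
  have hc : Continuous fun x : ℝ => Complex.exp (((-2 * π * x * ξ : ℝ) : ℂ) * Complex.I) := by
    fun_prop
  refine hf.norm.mono' (hc.aestronglyMeasurable.smul hf.1) (Eventually.of_forall fun x => ?_)
  rw [norm_smul, Complex.norm_exp_ofReal_mul_I, one_mul]

/-- Multiplication by `cos 2πΔx` averages the translates of the transform of `h_β` by `±Δ`. -/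
theorem fourier_poissonExtremal (hβ : 0 < β) (ξ : ℝ) :
    𝓕 (fun x : ℝ => poissonExtremal β Δ κ x) ξ =
      ((π / (2 * κ) * (Real.cosh (2 * π * β * Δ) * Real.exp (-(2 * π * β) * |ξ|) -
        Real.exp (-(2 * π * β) * |ξ - Δ|) / 2 - Real.exp (-(2 * π * β) * |ξ + Δ|) / 2) : ℝ) : ℂ) := by
  let H : ℝ → ℂ := fun x => (linePoissonKernel β x : ℂ)
  have hH : Integrable H := (integrable_linePoissonKernel hβ).ofReal
  let e : ℝ → ℝ → ℂ := fun ξ x => Complex.exp (((-2 * π * x * ξ : ℝ) : ℂ) * Complex.I) • H x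
  have he : ∀ ξ, Integrable (e ξ) := fun ξ => integrable_exp_smul hH ξ
  have hint : ∀ ξ, ∫ x, e ξ x = ((π * Real.exp (-(2 * π * β) * |ξ|) : ℝ) : ℂ) := by
    intro ξ
    rw [← fourier_linePoissonKernel hβ ξ, Real.fourier_real_eq_integral_exp_smul]
  have hpt : ∀ x : ℝ, Complex.exp (((-2 * π * x * ξ : ℝ) : ℂ) * Complex.I) •
      poissonExtremal β Δ κ x = ((1 / (2 * κ) : ℝ) : ℂ) *
        ((Real.cosh (2 * π * β * Δ) : ℂ) * e ξ x - (1 / 2) * e (ξ - Δ) x -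
          (1 / 2) * e (ξ + Δ) x) := by
    intro x
    have e1 : e (ξ - Δ) x = Complex.exp (((-2 * π * x * ξ : ℝ) : ℂ) * Complex.I) *
        Complex.exp (2 * π * Δ * x * Complex.I) * H x := by
      simp only [e, smul_eq_mul, ← Complex.exp_add]
      congr 2
      push_cast
      ring
    have e2 : e (ξ + Δ) x = Complex.exp (((-2 * π * x * ξ : ℝ) : ℂ) * Complex.I) *
        Complex.exp (-(2 * π * Δ * x) * Complex.I) * H x := by
      simp only [e, smul_eq_mul, ← Complex.exp_add]
      congr 2
      push_cast
      ring
    have e3 : Complex.cos (2 * π * Δ * x) =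
        (Complex.exp (2 * π * Δ * x * Complex.I) + Complex.exp (-(2 * π * Δ * x) * Complex.I)) / 2 := by
      rw [Complex.cos]
    rw [e1, e2, poissonExtremal_ofReal hβ]
    simp only [e, H, smul_eq_mul]
    push_cast
    rw [e3]
    ring
  rw [Real.fourier_real_eq_integral_exp_smul]
  simp_rw [hpt]
  have hsub : Integrable fun x => (Real.cosh (2 * π * β * Δ) : ℂ) * e ξ x -
      (1 / 2) * e (ξ - Δ) x := ((he _).const_mul _).sub ((he _).const_mul _)
  rw [integral_const_mul, integral_sub hsub
    ((he _).const_mul _), integral_sub ((he _).const_mul _) ((he _).const_mul _),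
    integral_const_mul, integral_const_mul, integral_const_mul, hint, hint, hint]
  push_cast
  ring

theorem fourier_poissonExtremal_neg (hβ : 0 < β) (ξ : ℝ) :
    𝓕 (fun x : ℝ => poissonExtremal β Δ κ x) (-ξ) = 𝓕 (fun x : ℝ => poissonExtremal β Δ κ x) ξ := by
  rw [fourier_poissonExtremal hβ, fourier_poissonExtremal hβ, abs_neg,
    show -ξ - Δ = -(ξ + Δ) by ring, show -ξ + Δ = -(ξ - Δ) by ring, abs_neg, abs_neg]
  congr 1
  ring

theorem fourier_poissonExtremal_abs (hβ : 0 < β) (ξ : ℝ) :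
    𝓕 (fun x : ℝ => poissonExtremal β Δ κ x) |ξ| = 𝓕 (fun x : ℝ => poissonExtremal β Δ κ x) ξ := by
  rcases abs_choice ξ with h | h <;> rw [h]
  exact fourier_poissonExtremal_neg hβ ξ

/-- Beyond `Δ` all three exponentials are on the same branch, and the average of the translates is
exactly `cosh(2πβΔ)` times the central one. -/
theorem fourier_poissonExtremal_of_lt (hβ : 0 < β) (hΔ : 0 < Δ) {ξ : ℝ} (hξ : Δ < |ξ|) :
    𝓕 (fun x : ℝ => poissonExtremal β Δ κ x) ξ = 0 := by
  rw [← fourier_poissonExtremal_abs hβ, fourier_poissonExtremal hβ, abs_abs]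
  set t := |ξ|
  rw [abs_of_pos (by linarith : 0 < t - Δ), abs_of_pos (by linarith : 0 < t + Δ), Real.cosh_eq]
  have h1 : Real.exp (-(2 * π * β) * (t - Δ)) =
      Real.exp (-(2 * π * β) * t) * Real.exp (2 * π * β * Δ) := by
    rw [← Real.exp_add]; ring_nf
  have h2 : Real.exp (-(2 * π * β) * (t + Δ)) =
      Real.exp (-(2 * π * β) * t) * Real.exp (-(2 * π * β * Δ)) := by
    rw [← Real.exp_add]; ring_nf
  rw [h1, h2]
  rw [Complex.ofReal_eq_zero]
  ring

theorem fourier_poissonExtremal_of_le (hβ : 0 < β) (hΔ : 0 < Δ) {ξ : ℝ} (hξ : |ξ| ≤ Δ) :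
    𝓕 (fun x : ℝ => poissonExtremal β Δ κ x) ξ =
      ((π * ((Real.exp (2 * π * β * (Δ - |ξ|)) - Real.exp (-(2 * π * β * (Δ - |ξ|)))) /
        (4 * κ)) : ℝ) : ℂ) := by
  rw [← fourier_poissonExtremal_abs hβ, fourier_poissonExtremal hβ, abs_abs]
  have ht := abs_nonneg ξ
  set t := |ξ|
  rw [abs_of_nonpos (by linarith : t - Δ ≤ 0), abs_of_pos (by linarith : 0 < t + Δ), Real.cosh_eq]
  have h1 : Real.exp (-(2 * π * β) * -(t - Δ)) = Real.exp (-(2 * π * β * (Δ - t))) := by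
    ring_nf
  have h2 : Real.exp (-(2 * π * β) * (t + Δ)) =
      Real.exp (-(2 * π * β) * t) * Real.exp (-(2 * π * β * Δ)) := by
    rw [← Real.exp_add]; ring_nf
  have h3 : Real.exp (2 * π * β * (Δ - t)) =
      Real.exp (-(2 * π * β) * t) * Real.exp (2 * π * β * Δ) := by
    rw [← Real.exp_add]; ring_nf
  rw [h1, h2, h3]
  congr 1
  ring

theorem integral_poissonExtremal (hβ : 0 < β) (hΔ : 0 < Δ) :
    ∫ x : ℝ, poissonExtremal β Δ κ x = ((π * ((Real.exp (2 * π * β * Δ) -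
      Real.exp (-(2 * π * β * Δ))) / (4 * κ)) : ℝ) : ℂ) := by
  rw [← fourier_zero_eq_integral, fourier_poissonExtremal_of_le hβ hΔ (by simpa using hΔ.le)]
  simp

theorem integral_poissonExtremal_re (hβ : 0 < β) (hΔ : 0 < Δ) (hκ : 0 < κ) :
    ∫ x : ℝ, (poissonExtremal β Δ κ x).re = π * ((Real.exp (2 * π * β * Δ) -
      Real.exp (-(2 * π * β * Δ))) / (4 * κ)) := by
  have h : ∫ x : ℝ, (poissonExtremal β Δ κ x).re = (∫ x : ℝ, poissonExtremal β Δ κ x).re :=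
    integral_re (integrable_poissonExtremal hβ hΔ hκ)
  rw [h, integral_poissonExtremal hβ hΔ, Complex.ofReal_re]

end
end

/-! ### Optimality and uniqueness -/

noncomputable section

theorem QuadDecay.sub {K L : ℂ → ℂ} {M N c : ℝ} (hK : QuadDecay K M c) (hL : QuadDecay L N c) :
    QuadDecay (fun z => K z - L z) (M + N) c where
  diff := hK.diff.sub hL.diff
  pos := hK.pos
  bound z := by
    refine (norm_sub_le _ _).trans ?_
    rw [add_mul, add_div]
    exact add_le_add (hK.bound z) (hL.bound z)

theorem integral_comp_affine (f : ℝ → ℝ) {Δ : ℝ} (hΔ : 0 < Δ) (t : ℝ) :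
    ∫ x : ℝ, f (t + x / Δ) = Δ * ∫ x : ℝ, f x := by
  rw [Measure.integral_comp_div (fun x => f (t + x)) Δ, integral_add_left_eq_self,
    abs_of_pos hΔ, smul_eq_mul]

theorem integrable_comp_affine {f : ℝ → ℂ} (hf : Integrable f) {Δ : ℝ} (hΔ : 0 < Δ) (t : ℝ) :
    Integrable fun x : ℝ => f (t + x / Δ) :=
  (hf.comp_add_left t).comp_div hΔ.ne'

theorem exists_norm_le_exp_im_affine {F : ℂ → ℂ} {Δ : ℝ} (hΔ : 0 < Δ) (hd : Differentiable ℂ F)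
    (hg : GrowthType (2 * π * Δ) F) (hi : Integrable fun x : ℝ => F x) (t : ℝ) :
    Differentiable ℂ (fun z => F (t + z / Δ)) ∧
      Integrable (fun x : ℝ => F (t + (x : ℂ) / Δ)) ∧
      ∃ M : ℝ, ∀ z, ‖F (t + z / Δ)‖ ≤ M * Real.exp (2 * π * |z.im|) := by
  have h1 : Differentiable ℂ (fun z => F (t + z / Δ)) := by fun_prop
  have h2 : Integrable (fun x : ℝ => F (t + (x : ℂ) / Δ)) := by
    simpa using integrable_comp_affine hi hΔ t
  exact ⟨h1, h2, exists_norm_le_exp_im_of_integrable (by positivity) h1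
    (hg.comp_affine (by positivity) hΔ t) h2⟩

theorem HasExponentialType.growthType {τ : ℝ} {F : ℂ → ℂ} (hF : HasExponentialType τ F)
    (hc : Continuous F) : GrowthType τ F :=
  fun _ hε => hF.exists_norm_le hc hε

theorem GrowthType.add {τ : ℝ} {F G : ℂ → ℂ} (hF : GrowthType τ F) (hG : GrowthType τ G) :
    GrowthType τ (fun z => F z + G z) := by
  have h0 : GrowthType τ (fun z => -G z) := fun ε hε => by simpa using hG ε hε
  simpa using hF.sub h0

/-- Rescaled form of `node_excess_le` for `F = D + A`: the auxiliary `A` makes the sum nonnegative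
and cancels by exact quadrature. -/
theorem node_le_integral {D A : ℂ → ℂ} {B c Δ t : ℝ} (hΔ : 0 < Δ) (hd : Differentiable ℂ D)
    (hg : GrowthType (2 * π * Δ) D) (hi : Integrable fun x : ℝ => D x)
    (hAd : Differentiable ℂ A) (hAg : GrowthType (2 * π * Δ) A) (hAi : Integrable fun x : ℝ => A x)
    (hA : QuadDecay (fun z => A (t + z / Δ)) B c) (h0 : ∀ x : ℝ, 0 ≤ (D x).re + (A x).re)
    (hn : ∀ n : ℤ, 0 ≤ (D (t + n / Δ)).re) (m : ℤ) :
    (D (t + m / Δ)).re ≤ Δ * ∫ x : ℝ, (D x).re := by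
  obtain ⟨h1, h2, M, h3⟩ := exists_norm_le_exp_im_affine hΔ (hd.add hAd)
    (hg.add hAg) (hi.add hAi) t
  have h := node_excess_le (F := fun z => D (t + z / Δ) + A (t + z / Δ)) h1 h3
    (fun x => by simpa using h0 (t + x / Δ)) h2 hA (fun n => by simpa using hn n) m
  have e1 : ∫ x : ℝ, (D (t + (x : ℂ) / Δ) + A (t + (x : ℂ) / Δ)).re =
      Δ * ∫ x : ℝ, ((D x).re + (A x).re) := by
    rw [← integral_comp_affine _ hΔ t]; simp
  have e2 : ∫ x : ℝ, (A (t + (x : ℂ) / Δ)).re = Δ * ∫ x : ℝ, (A x).re := by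
    rw [← integral_comp_affine _ hΔ t]; simp
  have e3 : ∫ x : ℝ, ((D x).re + (A x).re) = (∫ x : ℝ, (D x).re) + ∫ x : ℝ, (A x).re :=
    integral_add hi.re hAi.re
  rw [e1, e2, e3, Complex.add_re] at h
  linarith

theorem eq_zero_of_double_zeros_affine {D : ℂ → ℂ} {Δ t : ℝ} (hΔ : 0 < Δ)
    (hd : Differentiable ℂ D) (hg : GrowthType (2 * π * Δ) D) (hi : Integrable fun x : ℝ => D x)
    (h0 : ∀ n : ℤ, D (t + n / Δ) = 0) (h1 : ∀ n : ℤ, deriv D (t + n / Δ) = 0) (z : ℂ) :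
    D z = 0 := by
  obtain ⟨hd', hi', M, hM⟩ := exists_norm_le_exp_im_affine hΔ hd hg hi t
  have hΔ' : (Δ : ℂ) ≠ 0 := Complex.ofReal_ne_zero.2 hΔ.ne'
  have h := eq_zero_of_double_zeros hd' hM hi' h0 (fun n => ?_) (Δ * (z - t))
  · simp only [mul_div_cancel_left₀ _ hΔ', add_sub_cancel] at h
    exact h
  · have hder : HasDerivAt (fun w : ℂ => (t : ℂ) + w / Δ) (1 / Δ) (n : ℂ) :=
      ((hasDerivAt_id (n : ℂ)).div_const (Δ : ℂ)).const_add (t : ℂ)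
    have := (hd ((t : ℂ) + n / Δ)).hasDerivAt.comp (n : ℂ) hder
    rw [h1, zero_mul] at this
    exact this.deriv

theorem hasDerivAt_re_of_isRealEntire {g : ℂ → ℂ} (hg : IsRealEntire g) (x : ℝ) :
    HasDerivAt (fun y : ℝ => (g y).re) (deriv g x).re x ∧ (deriv g x).im = 0 := by
  have h := (hg.1 x).hasDerivAt.comp_ofReal
  have him : HasDerivAt (fun y : ℝ => (g y).im) (deriv g x).im x :=
    Complex.imCLM.hasFDerivAt.comp_hasDerivAt x h
  refine ⟨Complex.reCLM.hasFDerivAt.comp_hasDerivAt x h, ?_⟩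
  have h0 : (fun y : ℝ => (g y).im) = fun _ => 0 := funext hg.2
  rw [h0] at him
  exact him.unique (hasDerivAt_const x 0)

/-- Both functions are tangent to `φ` at `x`, so both real derivatives equal `φ'(x)`; the imaginary
parts vanish. -/
theorem deriv_eq_of_isLocalExtr {g m : ℂ → ℂ} (hg : IsRealEntire g) (hm : IsRealEntire m)
    {φ : ℝ → ℝ} {x : ℝ} (hφ : DifferentiableAt ℝ φ x)
    (h1 : IsLocalExtr (fun y : ℝ => (g y).re - φ y) x)
    (h2 : IsLocalExtr (fun y : ℝ => (m y).re - φ y) x) : deriv g x = deriv m x := by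
  obtain ⟨hg1, hg2⟩ := hasDerivAt_re_of_isRealEntire hg x
  obtain ⟨hm1, hm2⟩ := hasDerivAt_re_of_isRealEntire hm x
  have e1 := h1.hasDerivAt_eq_zero (hg1.sub hφ.hasDerivAt)
  have e2 := h2.hasDerivAt_eq_zero (hm1.sub hφ.hasDerivAt)
  exact Complex.ext (by linarith) (by rw [hg2, hm2])

theorem differentiable_linePoissonKernel {β : ℝ} (hβ : 0 < β) :
    Differentiable ℝ (linePoissonKernel β) := by
  unfold linePoissonKernel
  intro x
  have : β ^ 2 + x ^ 2 ≠ 0 := by positivity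
  fun_prop (disch := assumption)

/-- The extremal majorant. -/
abbrev poissonMajorant (β Δ : ℝ) : ℂ → ℂ := poissonExtremal β Δ (Real.sinh (π * β * Δ) ^ 2)

/-- The extremal minorant. -/
abbrev poissonMinorant (β Δ : ℝ) : ℂ → ℂ := poissonExtremal β Δ (Real.cosh (π * β * Δ) ^ 2)

section
variable {β Δ : ℝ}

theorem sinh_sq_pos (hβ : 0 < β) (hΔ : 0 < Δ) : 0 < Real.sinh (π * β * Δ) ^ 2 :=
  pow_pos (Real.sinh_pos_iff.2 (by positivity)) 2

theorem cosh_sq_pos : 0 < Real.cosh (π * β * Δ) ^ 2 := pow_pos (Real.cosh_pos _) 2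

theorem growthType_poissonExtremal {κ : ℝ} (hβ : 0 < β) (hΔ : 0 < Δ) (hκ : 0 < κ) :
    GrowthType (2 * π * Δ) (poissonExtremal β Δ κ) :=
  (hasExponentialType_poissonExtremal hβ hΔ hκ).growthType differentiable_poissonExtremal.continuous

theorem poissonMajorant_node (hβ : 0 < β) (hΔ : 0 < Δ) (n : ℤ) :
    (poissonMajorant β Δ ((n / Δ : ℝ) : ℂ)).re = linePoissonKernel β (n / Δ) := by
  rw [poissonExtremal_majorant_re hβ hΔ,
    show π * Δ * (n / Δ) = n * π by field_simp, Real.sin_int_mul_pi]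
  simp

theorem poissonMinorant_node (hβ : 0 < β) (hΔ : 0 < Δ) (n : ℤ) :
    (poissonMinorant β Δ ((1 / (2 * Δ) + n / Δ : ℝ) : ℂ)).re =
      linePoissonKernel β (1 / (2 * Δ) + n / Δ) := by
  rw [poissonExtremal_minorant_re hβ,
    show π * Δ * (1 / (2 * Δ) + n / Δ) = n * π + π / 2 by field_simp; ring,
    Real.cos_add_pi_div_two, Real.sin_int_mul_pi]
  simp

/-- The gap works for both problems: `(g - m⁺) + (m⁺ - m⁻) = g - m⁻` for a majorant `g`, and `(m⁻ -
g) + (m⁺ - m⁻) = m⁺ - g` for a minorant `g`. -/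
theorem node_le_integral_of_gap (hβ : 0 < β) (hΔ : 0 < Δ) {D : ℂ → ℂ} {t : ℝ}
    (hd : Differentiable ℂ D) (hg : GrowthType (2 * π * Δ) D) (hi : Integrable fun x : ℝ => D x)
    (h0 : ∀ x : ℝ, 0 ≤ (D x).re + (poissonMajorant β Δ x - poissonMinorant β Δ x).re)
    (hn : ∀ n : ℤ, 0 ≤ (D (t + n / Δ)).re) (m : ℤ) :
    (D (t + m / Δ)).re ≤ Δ * ∫ x : ℝ, (D x).re :=
  node_le_integral (A := fun z => poissonMajorant β Δ z - poissonMinorant β Δ z) hΔ hd hg hi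
    (differentiable_poissonExtremal.sub differentiable_poissonExtremal)
    ((growthType_poissonExtremal hβ hΔ (sinh_sq_pos hβ hΔ)).sub
      (growthType_poissonExtremal hβ hΔ cosh_sq_pos))
    ((integrable_poissonExtremal hβ hΔ (sinh_sq_pos hβ hΔ)).sub
      (integrable_poissonExtremal hβ hΔ cosh_sq_pos))
    ((quadDecay_poissonExtremal hβ hΔ (sinh_sq_pos hβ hΔ) t).sub
      (quadDecay_poissonExtremal hβ hΔ cosh_sq_pos t)) h0 hn m

/-- At the nodes `n/Δ` the extremal majorant equals `h_β`, so the difference is nonnegative there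
and bounded by `Δ` times its integral. A nonpositive integral therefore forces contact at every
node. -/
theorem integral_poissonMajorant_le (hβ : 0 < β) (hΔ : 0 < Δ) {g : ℂ → ℂ} (hg : IsRealEntire g)
    (hτ : HasExponentialType (2 * π * Δ) g) (hi : Integrable fun x : ℝ => g x)
    (hmaj : ∀ x : ℝ, linePoissonKernel β x ≤ (g x).re) :
    ∫ x : ℝ, (poissonMajorant β Δ x).re ≤ ∫ x : ℝ, (g x).re ∧
      (∫ x : ℝ, (g x).re ≤ ∫ x : ℝ, (poissonMajorant β Δ x).re → g = poissonMajorant β Δ) := by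
  have hκ := sinh_sq_pos hβ hΔ
  have hpi := integrable_poissonExtremal hβ hΔ hκ
  have hre := isRealEntire_poissonExtremal (Δ := Δ) (κ := Real.sinh (π * β * Δ) ^ 2) hβ
  let D : ℂ → ℂ := fun z => g z - poissonMajorant β Δ z
  have hDd : Differentiable ℂ D := hg.1.sub hre.1
  have hDg : GrowthType (2 * π * Δ) D :=
    (hτ.growthType hg.1.continuous).sub (growthType_poissonExtremal hβ hΔ hκ)
  have hDi : Integrable fun x : ℝ => D x := hi.sub hpi
  have hDint : ∫ x : ℝ, (D x).re = (∫ x : ℝ, (g x).re) - ∫ x : ℝ, (poissonMajorant β Δ x).re := by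
    simp only [D, Complex.sub_re]
    exact integral_sub hi.re hpi.re
  have hcast : ∀ n : ℤ, ((0 : ℝ) : ℂ) + n / Δ = ((n / Δ : ℝ) : ℂ) := fun n => by push_cast; ring
  have hnode : ∀ n : ℤ, 0 ≤ (D (((0 : ℝ) : ℂ) + n / Δ)).re := fun n => by
    rw [hcast, Complex.sub_re, poissonMajorant_node hβ hΔ]
    exact sub_nonneg.2 (hmaj _)
  have key := node_le_integral_of_gap hβ hΔ hDd hDg hDi (fun x => by
    simp only [D, Complex.sub_re]
    linarith [hmaj x, minorant_le_linePoissonKernel (Δ := Δ) hβ x]) hnode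
  refine ⟨?_, fun hle => ?_⟩
  · have h1 := (hnode 0).trans (key 0)
    rw [hDint] at h1
    linarith [nonneg_of_mul_nonneg_right h1 hΔ]
  · have hz : ∀ n : ℤ, (D (((0 : ℝ) : ℂ) + n / Δ)).re = 0 := fun n => by
      refine le_antisymm ((key n).trans ?_) (hnode n)
      rw [hDint]
      exact mul_nonpos_of_nonneg_of_nonpos hΔ.le (by linarith)
    funext z
    refine sub_eq_zero.1 (eq_zero_of_double_zeros_affine (t := 0) hΔ hDd hDg hDi (fun n => ?_)
      (fun n => ?_) z)
    · refine Complex.ext (hz n) ?_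
      rw [hcast, Complex.sub_im, hg.2, hre.2, sub_zero, Complex.zero_im]
    -- At a node both `g - h_β` and the extremal difference attain their minimum `0`, so the
    -- derivatives agree.
    · have hzn := hz n
      rw [hcast, Complex.sub_re, poissonMajorant_node hβ hΔ] at hzn
      rw [hcast, deriv_fun_sub (hg.1 _) (hre.1 _), sub_eq_zero]
      refine deriv_eq_of_isLocalExtr hg hre (differentiable_linePoissonKernel hβ _)
        (Or.inl (Eventually.of_forall fun y => ?_)) (Or.inl (Eventually.of_forall fun y => ?_))
      · simp only [hzn]; exact sub_nonneg.2 (hmaj y)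
      · simp only [poissonMajorant_node hβ hΔ, sub_self]
        exact sub_nonneg.2 (linePoissonKernel_le_majorant hβ hΔ y)

/-- Mirror image of the majorant case; the nodes are now the zeros of `cos(πΔx)`, hence `t =
1/(2Δ)`. -/
theorem le_integral_poissonMinorant (hβ : 0 < β) (hΔ : 0 < Δ) {g : ℂ → ℂ} (hg : IsRealEntire g)
    (hτ : HasExponentialType (2 * π * Δ) g) (hi : Integrable fun x : ℝ => g x)
    (hmin : ∀ x : ℝ, (g x).re ≤ linePoissonKernel β x) :
    ∫ x : ℝ, (g x).re ≤ ∫ x : ℝ, (poissonMinorant β Δ x).re ∧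
      (∫ x : ℝ, (poissonMinorant β Δ x).re ≤ ∫ x : ℝ, (g x).re → g = poissonMinorant β Δ) := by
  have hκ := cosh_sq_pos (β := β) (Δ := Δ)
  have hpi := integrable_poissonExtremal hβ hΔ hκ
  have hre := isRealEntire_poissonExtremal (Δ := Δ) (κ := Real.cosh (π * β * Δ) ^ 2) hβ
  let D : ℂ → ℂ := fun z => poissonMinorant β Δ z - g z
  have hDd : Differentiable ℂ D := hre.1.sub hg.1
  have hDg : GrowthType (2 * π * Δ) D :=
    (growthType_poissonExtremal hβ hΔ hκ).sub (hτ.growthType hg.1.continuous)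
  have hDi : Integrable fun x : ℝ => D x := hpi.sub hi
  have hDint : ∫ x : ℝ, (D x).re = (∫ x : ℝ, (poissonMinorant β Δ x).re) - ∫ x : ℝ, (g x).re := by
    simp only [D, Complex.sub_re]
    exact integral_sub hpi.re hi.re
  have hcast : ∀ n : ℤ, ((1 / (2 * Δ) : ℝ) : ℂ) + n / Δ = ((1 / (2 * Δ) + n / Δ : ℝ) : ℂ) :=
    fun n => by push_cast; ring
  have hnode : ∀ n : ℤ, 0 ≤ (D (((1 / (2 * Δ) : ℝ) : ℂ) + n / Δ)).re := fun n => by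
    rw [hcast, Complex.sub_re, poissonMinorant_node hβ hΔ]
    exact sub_nonneg.2 (hmin _)
  have key := node_le_integral_of_gap hβ hΔ hDd hDg hDi (fun x => by
    simp only [D, Complex.sub_re]
    linarith [hmin x, linePoissonKernel_le_majorant hβ hΔ x]) hnode
  refine ⟨?_, fun hle => ?_⟩
  · have h1 := (hnode 0).trans (key 0)
    rw [hDint] at h1
    linarith [nonneg_of_mul_nonneg_right h1 hΔ]
  · have hz : ∀ n : ℤ, (D (((1 / (2 * Δ) : ℝ) : ℂ) + n / Δ)).re = 0 := fun n => by
      refine le_antisymm ((key n).trans ?_) (hnode n)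
      rw [hDint]
      exact mul_nonpos_of_nonneg_of_nonpos hΔ.le (by linarith)
    funext z
    refine (sub_eq_zero.1 (eq_zero_of_double_zeros_affine (t := 1 / (2 * Δ)) hΔ hDd hDg hDi
      (fun n => ?_) (fun n => ?_) z)).symm
    · refine Complex.ext (hz n) ?_
      rw [hcast, Complex.sub_im, hg.2, hre.2, sub_zero, Complex.zero_im]
    · have hzn := hz n
      rw [hcast, Complex.sub_re, poissonMinorant_node hβ hΔ] at hzn
      rw [hcast, deriv_fun_sub (hre.1 _) (hg.1 _), sub_eq_zero]
      refine deriv_eq_of_isLocalExtr hre hg (differentiable_linePoissonKernel hβ _)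
        (Or.inr (Eventually.of_forall fun y => ?_)) (Or.inr (Eventually.of_forall fun y => ?_))
      · simp only [poissonMinorant_node hβ hΔ, sub_self]
        exact sub_nonpos.2 (minorant_le_linePoissonKernel hβ y)
      · have h1 := hmin y
        linarith

theorem isAdmissiblePair_poisson (hβ : 0 < β) (hΔ : 0 < Δ) :
    IsAdmissiblePair β Δ (poissonMinorant β Δ) (poissonMajorant β Δ) where
  realEntire_minus := isRealEntire_poissonExtremal hβ
  realEntire_plus := isRealEntire_poissonExtremal hβ
  expType_minus := hasExponentialType_poissonExtremal hβ hΔ cosh_sq_pos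
  expType_plus := hasExponentialType_poissonExtremal hβ hΔ (sinh_sq_pos hβ hΔ)
  minorant := minorant_le_linePoissonKernel hβ
  majorant := linePoissonKernel_le_majorant hβ hΔ

theorem IsRealEntire.continuous_re {g : ℂ → ℂ} (hg : IsRealEntire g) :
    Continuous fun x : ℝ => (g x).re :=
  Complex.continuous_re.comp (hg.1.continuous.comp Complex.continuous_ofReal)

theorem IsRealEntire.integrable_of_re {g : ℂ → ℂ} (hg : IsRealEntire g)
    (h : Integrable fun x : ℝ => (g x).re) : Integrable fun x : ℝ => g x :=
  h.ofReal.congr (Eventually.of_forall fun x => Complex.ext rfl (by simp [hg.2 x]))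

namespace IsAdmissiblePair

variable {gMinus gPlus : ℂ → ℂ}

theorem gap_nonneg (hg : IsAdmissiblePair β Δ gMinus gPlus) (x : ℝ) :
    0 ≤ (gPlus x).re - (gMinus x).re :=
  sub_nonneg.2 ((hg.minorant x).trans (hg.majorant x))

theorem continuous_gap (hg : IsAdmissiblePair β Δ gMinus gPlus) :
    Continuous fun x : ℝ => (gPlus x).re - (gMinus x).re :=
  hg.realEntire_plus.continuous_re.sub hg.realEntire_minus.continuous_re

theorem integrable_gap (hg : IsAdmissiblePair β Δ gMinus gPlus)
    (h : pairError gMinus gPlus ≠ ⊤) :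
    Integrable fun x : ℝ => (gPlus x).re - (gMinus x).re :=
  (lintegral_ofReal_ne_top_iff_integrable hg.continuous_gap.aestronglyMeasurable
    (Eventually.of_forall hg.gap_nonneg)).1 h

theorem integrable_plus (hβ : 0 < β) (hg : IsAdmissiblePair β Δ gMinus gPlus)
    (h : pairError gMinus gPlus ≠ ⊤) : Integrable fun x : ℝ => gPlus x := by
  refine hg.realEntire_plus.integrable_of_re ?_
  have hcont := hg.realEntire_plus.continuous_re.sub (differentiable_linePoissonKernel hβ).continuous
  -- `h_β` lies between the two functions, so `0 ≤ g⁺ - h_β ≤ g⁺ - g⁻`.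
  have h1 : Integrable fun x : ℝ => (gPlus x).re - linePoissonKernel β x :=
    (hg.integrable_gap h).mono' hcont.aestronglyMeasurable (Eventually.of_forall fun x => by
      rw [Real.norm_eq_abs, abs_of_nonneg (sub_nonneg.2 (hg.majorant x))]
      linarith [hg.minorant x])
  exact (h1.add (integrable_linePoissonKernel hβ)).congr (Eventually.of_forall fun x => by simp)

theorem integrable_minus (hβ : 0 < β) (hg : IsAdmissiblePair β Δ gMinus gPlus)
    (h : pairError gMinus gPlus ≠ ⊤) : Integrable fun x : ℝ => gMinus x := by
  refine hg.realEntire_minus.integrable_of_re ?_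
  exact ((hg.integrable_plus hβ h).re.sub (hg.integrable_gap h)).congr
    (Eventually.of_forall fun x => by simp)

theorem pairError_eq (hg : IsAdmissiblePair β Δ gMinus gPlus)
    (hp : Integrable fun x : ℝ => gPlus x) (hm : Integrable fun x : ℝ => gMinus x) :
    pairError gMinus gPlus =
      ENNReal.ofReal ((∫ x : ℝ, (gPlus x).re) - ∫ x : ℝ, (gMinus x).re) := by
  have h : ∫ x : ℝ, ((gPlus x).re - (gMinus x).re) =
      (∫ x : ℝ, (gPlus x).re) - ∫ x : ℝ, (gMinus x).re := integral_sub hp.re hm.re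
  have hi : Integrable fun x : ℝ => (gPlus x).re - (gMinus x).re := hp.re.sub hm.re
  rw [← h, pairError, ofReal_integral_eq_lintegral_ofReal hi (Eventually.of_forall hg.gap_nonneg)]

end IsAdmissiblePair

theorem isExtremalPair_poisson (hβ : 0 < β) (hΔ : 0 < Δ) :
    IsExtremalPair β Δ (poissonMinorant β Δ) (poissonMajorant β Δ) := by
  have hm := isAdmissiblePair_poisson hβ hΔ
  refine ⟨hm, fun gMinus gPlus hg => ?_⟩
  by_cases h : pairError gMinus gPlus = ⊤
  · rw [h]; exact le_top
  have hp := hg.integrable_plus hβ h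
  have hq := hg.integrable_minus hβ h
  rw [hg.pairError_eq hp hq, hm.pairError_eq
    (integrable_poissonExtremal hβ hΔ (sinh_sq_pos hβ hΔ))
    (integrable_poissonExtremal hβ hΔ cosh_sq_pos)]
  refine ENNReal.ofReal_le_ofReal (sub_le_sub ?_ ?_)
  · exact (integral_poissonMajorant_le hβ hΔ hg.realEntire_plus hg.expType_plus hp hg.majorant).1
  · exact (le_integral_poissonMinorant hβ hΔ hg.realEntire_minus hg.expType_minus hq hg.minorant).1

theorem IsExtremalPair.eq_poisson (hβ : 0 < β) (hΔ : 0 < Δ) {gMinus gPlus : ℂ → ℂ}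
    (hg : IsExtremalPair β Δ gMinus gPlus) :
    gMinus = poissonMinorant β Δ ∧ gPlus = poissonMajorant β Δ := by
  obtain ⟨hg, hmin⟩ := hg
  have hm := isAdmissiblePair_poisson hβ hΔ
  have hle := hmin _ _ hm
  rw [hm.pairError_eq (integrable_poissonExtremal hβ hΔ (sinh_sq_pos hβ hΔ))
    (integrable_poissonExtremal hβ hΔ cosh_sq_pos)] at hle
  have h : pairError gMinus gPlus ≠ ⊤ := ne_top_of_le_ne_top ENNReal.ofReal_ne_top hle
  have hp := hg.integrable_plus hβ h
  have hq := hg.integrable_minus hβ h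
  obtain ⟨h1, h2⟩ :=
    integral_poissonMajorant_le hβ hΔ hg.realEntire_plus hg.expType_plus hp hg.majorant
  obtain ⟨h3, h4⟩ :=
    le_integral_poissonMinorant hβ hΔ hg.realEntire_minus hg.expType_minus hq hg.minorant
  -- The two one-sided inequalities add up to the reverse of `hle`, so each is an equality. `ofReal`
  -- truncates, so the Poisson gap must first be seen to be nonnegative.
  rw [hg.pairError_eq hp hq, ENNReal.ofReal_le_ofReal_iff] at hle
  · exact ⟨h4 (by linarith), h2 (by linarith)⟩
  · exact sub_nonneg.2 (integral_mono (integrable_poissonExtremal hβ hΔ cosh_sq_pos).re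
      (integrable_poissonExtremal hβ hΔ (sinh_sq_pos hβ hΔ)).re
      fun x => sub_nonneg.1 (hm.gap_nonneg x))

/-! ### Explicit integrals, closed forms and assembly -/

theorem exp_sub_exp_sq (a : ℝ) : (Real.exp a - Real.exp (-a)) ^ 2 = 4 * Real.sinh a ^ 2 := by
  rw [Real.sinh_eq]; ring

theorem exp_add_exp_sq (a : ℝ) : (Real.exp a + Real.exp (-a)) ^ 2 = 4 * Real.cosh a ^ 2 := by
  rw [Real.cosh_eq]; ring

theorem integral_majorant_sub (hβ : 0 < β) (hΔ : 0 < Δ) :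
    ∫ x : ℝ, ((poissonMajorant β Δ x).re - linePoissonKernel β x) =
      2 * π * Real.exp (-2 * π * β * Δ) / (1 - Real.exp (-2 * π * β * Δ)) := by
  have h : ∫ x : ℝ, ((poissonMajorant β Δ x).re - linePoissonKernel β x) =
      (∫ x : ℝ, (poissonMajorant β Δ x).re) - ∫ x : ℝ, linePoissonKernel β x :=
    integral_sub (integrable_poissonExtremal hβ hΔ (sinh_sq_pos hβ hΔ)).re
      (integrable_linePoissonKernel hβ)
  rw [h, integral_poissonExtremal_re hβ hΔ (sinh_sq_pos hβ hΔ), integral_linePoissonKernel hβ,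
    ← exp_sub_exp_sq, show 2 * π * β * Δ = 2 * (π * β * Δ) by ring,
    show -2 * π * β * Δ = -(2 * (π * β * Δ)) by ring]
  have ha : 0 < π * β * Δ := by positivity
  set a := π * β * Δ
  have e1 : Real.exp (2 * a) = Real.exp a ^ 2 := by rw [← Real.exp_nat_mul]; norm_num
  rw [Real.exp_neg, Real.exp_neg, e1]
  have hq : 1 < Real.exp a := Real.one_lt_exp_iff.2 ha
  set q := Real.exp a
  have hq2 : q ^ 2 - 1 ≠ 0 := by nlinarith
  have hq0 : q ≠ 0 := by linarith
  have e2 : q - q⁻¹ = (q ^ 2 - 1) / q := by field_simp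
  have e3 : 1 - (q ^ 2)⁻¹ = (q ^ 2 - 1) / q ^ 2 := by field_simp
  rw [e2, e3]
  field_simp
  ring

theorem integral_sub_minorant (hβ : 0 < β) (hΔ : 0 < Δ) :
    ∫ x : ℝ, (linePoissonKernel β x - (poissonMinorant β Δ x).re) =
      2 * π * Real.exp (-2 * π * β * Δ) / (1 + Real.exp (-2 * π * β * Δ)) := by
  have h : ∫ x : ℝ, (linePoissonKernel β x - (poissonMinorant β Δ x).re) =
      (∫ x : ℝ, linePoissonKernel β x) - ∫ x : ℝ, (poissonMinorant β Δ x).re :=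
    integral_sub (integrable_linePoissonKernel hβ) (integrable_poissonExtremal hβ hΔ cosh_sq_pos).re
  rw [h, integral_poissonExtremal_re hβ hΔ cosh_sq_pos, integral_linePoissonKernel hβ,
    ← exp_add_exp_sq, show 2 * π * β * Δ = 2 * (π * β * Δ) by ring,
    show -2 * π * β * Δ = -(2 * (π * β * Δ)) by ring]
  set a := π * β * Δ
  have e1 : Real.exp (2 * a) = Real.exp a ^ 2 := by rw [← Real.exp_nat_mul]; norm_num
  rw [Real.exp_neg, Real.exp_neg, e1]
  have hq : 0 < Real.exp a := Real.exp_pos a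
  set q := Real.exp a
  have hq2 : q ^ 2 + 1 ≠ 0 := by positivity
  have e2 : q + q⁻¹ = (q ^ 2 + 1) / q := by field_simp
  have e3 : 1 + (q ^ 2)⁻¹ = (q ^ 2 + 1) / q ^ 2 := by field_simp
  rw [e2, e3]
  field_simp
  ring

theorem poissonExtremal_closed_form {κ : ℝ} {d : ℂ} (hd : d = 4 * κ) {z : ℂ}
    (hz : (β : ℂ) ^ 2 + z ^ 2 ≠ 0) :
    poissonExtremal β Δ κ z = ((β : ℂ) / ((β : ℂ) ^ 2 + z ^ 2)) *
      ((Complex.exp (2 * π * β * Δ) + Complex.exp (-(2 * π * β * Δ))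
        - 2 * Complex.cos (2 * π * Δ * z)) / d) := by
  refine mul_left_cancel₀ hz ?_
  rw [mul_poissonExtremal, hd, ← mul_assoc, mul_div_cancel₀ _ hz, Complex.cosh]
  ring

theorem cexp_sub_cexp_sq (a : ℝ) :
    (Complex.exp a - Complex.exp (-a)) ^ 2 = 4 * ((Real.sinh a ^ 2 : ℝ) : ℂ) := by
  exact_mod_cast exp_sub_exp_sq a

theorem cexp_add_cexp_sq (a : ℝ) :
    (Complex.exp a + Complex.exp (-a)) ^ 2 = 4 * ((Real.cosh a ^ 2 : ℝ) : ℂ) := by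
  exact_mod_cast exp_add_exp_sq a

end
end

theorem mainTheorem5 :
    -- one universal constant for the three bounds at the end
    ∃ C : ℝ, 0 < C ∧ ∀ β Δ : ℝ, 0 < β → 0 < Δ →
      ∃ mMinus mPlus : ℂ → ℂ,
        -- existence and uniqueness of the extremal pair
        IsExtremalPair β Δ mMinus mPlus ∧
        (∀ gMinus gPlus : ℂ → ℂ, IsExtremalPair β Δ gMinus gPlus →
          gMinus = mMinus ∧ gPlus = mPlus) ∧
        -- both functions are even
        (∀ z : ℂ, mMinus (-z) = mMinus z) ∧
        (∀ z : ℂ, mPlus (-z) = mPlus z) ∧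
        -- distances to the Poisson kernel
        Integrable (fun x : ℝ => (mPlus x).re - linePoissonKernel β x) ∧
        ∫ x : ℝ, ((mPlus x).re - linePoissonKernel β x) =
          2 * π * Real.exp (-2 * π * β * Δ) / (1 - Real.exp (-2 * π * β * Δ)) ∧
        Integrable (fun x : ℝ => linePoissonKernel β x - (mMinus x).re) ∧
        ∫ x : ℝ, (linePoissonKernel β x - (mMinus x).re) =
          2 * π * Real.exp (-2 * π * β * Δ) / (1 + Real.exp (-2 * π * β * Δ)) ∧
        -- Fourier transforms
        Integrable (fun x : ℝ => mPlus x) ∧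
        Integrable (fun x : ℝ => mMinus x) ∧
        Continuous (𝓕 (fun x : ℝ => mPlus x)) ∧
        Continuous (𝓕 (fun x : ℝ => mMinus x)) ∧
        (∀ ξ : ℝ, 𝓕 (fun x : ℝ => mPlus x) (-ξ) = 𝓕 (fun x : ℝ => mPlus x) ξ) ∧
        (∀ ξ : ℝ, 𝓕 (fun x : ℝ => mMinus x) (-ξ) = 𝓕 (fun x : ℝ => mMinus x) ξ) ∧
        (∀ ξ : ℝ, Δ < |ξ| → 𝓕 (fun x : ℝ => mPlus x) ξ = 0) ∧
        (∀ ξ : ℝ, Δ < |ξ| → 𝓕 (fun x : ℝ => mMinus x) ξ = 0) ∧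
        (∀ ξ : ℝ, |ξ| ≤ Δ → 𝓕 (fun x : ℝ => mPlus x) ξ =
          ((π * ((Real.exp (2 * π * β * (Δ - |ξ|)) - Real.exp (-(2 * π * β * (Δ - |ξ|)))) /
            (Real.exp (π * β * Δ) - Real.exp (-(π * β * Δ))) ^ 2) : ℝ) : ℂ)) ∧
        (∀ ξ : ℝ, |ξ| ≤ Δ → 𝓕 (fun x : ℝ => mMinus x) ξ =
          ((π * ((Real.exp (2 * π * β * (Δ - |ξ|)) - Real.exp (-(2 * π * β * (Δ - |ξ|)))) /
            (Real.exp (π * β * Δ) + Real.exp (-(π * β * Δ))) ^ 2) : ℝ) : ℂ)) ∧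
        -- closed forms; the points `z = ± iβ` are removable singularities of the right-hand sides
        (∀ z : ℂ, (β : ℂ) ^ 2 + z ^ 2 ≠ 0 → mPlus z =
          ((β : ℂ) / ((β : ℂ) ^ 2 + z ^ 2)) *
            ((Complex.exp (2 * π * β * Δ) + Complex.exp (-(2 * π * β * Δ))
                - 2 * Complex.cos (2 * π * Δ * z)) /
              (Complex.exp (π * β * Δ) - Complex.exp (-(π * β * Δ))) ^ 2)) ∧
        (∀ z : ℂ, (β : ℂ) ^ 2 + z ^ 2 ≠ 0 → mMinus z =
          ((β : ℂ) / ((β : ℂ) ^ 2 + z ^ 2)) *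
            ((Complex.exp (2 * π * β * Δ) + Complex.exp (-(2 * π * β * Δ))
                - 2 * Complex.cos (2 * π * Δ * z)) /
              (Complex.exp (π * β * Δ) + Complex.exp (-(π * β * Δ))) ^ 2)) ∧
        (∀ x : ℝ, 0 ≤ (mMinus x).re) ∧
        -- bounds with a universal constant for `0 < β ≤ 1/2` and `Δ ≥ 1`
        (β ≤ 1 / 2 → 1 ≤ Δ →
          (∀ x : ℝ, 0 < (mMinus x).re ∧ (mMinus x).re ≤ linePoissonKernel β x ∧
            linePoissonKernel β x ≤ (mPlus x).re ∧ (mPlus x).re ≤ C * (1 / (β * (1 + x ^ 2)))) ∧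
          (∀ z : ℂ, ‖mPlus z‖ ≤
            C * (Δ ^ 2 * Real.exp (2 * π * Δ * |z.im|) / (β * (1 + Δ * ‖z‖)))) ∧
          (∀ z : ℂ, ‖mMinus z‖ ≤
            C * (β * Δ ^ 2 * Real.exp (2 * π * Δ * |z.im|) / (1 + Δ * ‖z‖)))) := by
  -- The `16` comes from the two sinc factors `2` and from a ratio of exponentials bounded by `4`.
  -- It also dominates the `3` of the bound on the real line.
  refine ⟨16 * π ^ 2, by positivity, fun β Δ hβ hΔ => ?_⟩
  have hs := sinh_sq_pos hβ hΔ
  have hc := cosh_sq_pos (β := β) (Δ := Δ)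
  have ip := integrable_poissonExtremal hβ hΔ hs
  have im := integrable_poissonExtremal hβ hΔ hc
  have ih := integrable_linePoissonKernel hβ
  refine ⟨poissonMinorant β Δ, poissonMajorant β Δ, isExtremalPair_poisson hβ hΔ,
    fun _ _ hg => hg.eq_poisson hβ hΔ, poissonExtremal_neg, poissonExtremal_neg,
    ip.re.sub ih, integral_majorant_sub hβ hΔ, ih.sub im.re, integral_sub_minorant hβ hΔ,
    ip, im, continuous_fourier_of_integrable ip, continuous_fourier_of_integrable im,
    fourier_poissonExtremal_neg hβ, fourier_poissonExtremal_neg hβ,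
    fun _ => fourier_poissonExtremal_of_lt hβ hΔ, fun _ => fourier_poissonExtremal_of_lt hβ hΔ,
    fun ξ hξ => ?_, fun ξ hξ => ?_, fun z hz => ?_, fun z hz => ?_,
    fun x => (minorant_pos hβ hΔ x).le, fun hβ' hΔ' => ⟨fun x => ⟨minorant_pos hβ hΔ x,
      minorant_le_linePoissonKernel hβ x, linePoissonKernel_le_majorant hβ hΔ x, ?_⟩,
      norm_majorant_le hβ hβ' hΔ', norm_minorant_le hβ hΔ⟩⟩
  · rw [exp_sub_exp_sq]
    exact fourier_poissonExtremal_of_le hβ hΔ hξ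
  · rw [exp_add_exp_sq]
    exact fourier_poissonExtremal_of_le hβ hΔ hξ
  · have h := cexp_sub_cexp_sq (π * β * Δ)
    push_cast at h
    exact poissonExtremal_closed_form (by push_cast; exact h) hz
  · have h := cexp_add_cexp_sq (π * β * Δ)
    push_cast at h
    exact poissonExtremal_closed_form (by push_cast; exact h) hz
  · refine (majorant_le_bound hβ hβ' hΔ' x).trans ?_
    gcongr
    nlinarith [Real.pi_gt_three]
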